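/- In the search with wildcards problem on $n$ bits, a string $x\in\{0,1\}^n$ is hidden and must be output. A query is a pair $q=(S,y)$ with $S\subseteq[n]$ and $y\in\{0,1\}^{S}$, and the reply is $\zeta(x,q)=1$ if $x_S=y$ and $\zeta(x,q)=0$ otherwise. A quantum algorithm starts in a fixed unit vector of $\mathbb C^{Q}\otimes\mathbb C^2\otimes W$, where $Q$ is the set of queries and the workspace $W$ is a complex Hilbert space. At each step, depending on the previous measurement outcomes, it does one of the following: it applies the oracle $O_x|q\rangle|z\rangle|w\rangle=|q\rangle|z\oplus\zeta(x,q)\rangle|w\rangle$ (one query), it applies a quantum operation independent of $x$ with finitely many classical outcomes (given by measurement operators $K_i$ with $\sum_i K_i^\dagger K_i=I$), or it halts and outputs a string. (i) There is a constant $C>0$ such that for every $n\ge 2$ there is a quantum algorithm with finite-dimensional workspace which, on every $x\in\{0,1\}^n$, outputs $x$ with probability $1$ and makes at most $C\sqrt n\log n$ queries in expectation. (The expectation is over the measurement outcomes, for each fixed $x$; no distribution on inputs is assumed.) (ii) For every $0\le\varepsilon<1/2$ there is a constant $c>0$ such that for every $n\ge0$ and every quantum algorithm which, on every $x\in\{0,1\}^n$,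 outputs $x$ with probability at least $1-\varepsilon$, there is an input $x$ on which its expected number of queries, and hence its worst-case number of queries, is at least $c\sqrt n$. -/

import Mathlib

open scoped ENNReal

namespace WildcardSearch

/-- A wildcard query `(S, y)`: a set `S ⊆ [n]` of positions and a string `y ∈ {0,1}^S`. -/
abbrev Query (n : ℕ) : Type := (S : Finset (Fin n)) × (S → Bool)

/-- The reply to the query `(S, y)` on the hidden string `x`: `1` if and only if `x_S = y`. -/
def reply {n : ℕ} (x : Fin n → Bool) (q : Query n) : Bool :=
  decide (∀ i : q.1, x i = q.2 i)

/-- The state space `ℂ^Query ⊗ ℂ² ⊗ W` of an algorithm: a query register, a one-qubit answer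
register, and a workspace `W`. A vector is written through its components
`ψ (q, z) ∈ W`, that is, `ψ = ∑ |q⟩ |z⟩ ψ(q, z)`. -/
abbrev State (n : ℕ) (W : Type*) : Type _ := PiLp 2 (fun _ : Query n × Bool => W)

/-- The oracle `O_x |q⟩|z⟩|w⟩ = |q⟩|z ⊕ reply(x, q)⟩|w⟩`. -/
def oracle {n : ℕ} {W : Type*} (x : Fin n → Bool) (ψ : State n W) : State n W :=
  WithLp.toLp 2 fun p => ψ (p.1, xor p.2 (reply x p.1))

/-- One elementary step of an algorithm: halt with a classical output, apply the oracle once,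
or apply a quantum operation that does not depend on the hidden string and has a classical outcome
`i < m`, given by measurement (Kraus) operators `K i` with `∑ i, (K i)† (K i) = 1`, that is,
whose outcome probabilities sum to one in every state. Unitaries are the case `m = 1`. -/
inductive Action (n : ℕ) (W : Type*) [NormedAddCommGroup W] [InnerProductSpace ℂ W] : Type _
  | output (y : Fin n → Bool) : Action n W
  | query : Action n W
  | measure (m : ℕ) (K : Fin m → (State n W →ₗ[ℂ] State n W))
      (hK : ∀ ψ : State n W, ∑ i, ‖K i ψ‖ ^ 2 = ‖ψ‖ ^ 2) : Action n W

/-- The classical control of an algorithm: the next step as a function of the outcomes of all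
previous steps, the oldest first (a query step is recorded as outcome `0`). Runs may be infinite. -/
abbrev Control (n : ℕ) (W : Type*) [NormedAddCommGroup W] [InnerProductSpace ℂ W] : Type _ :=
  List ℕ → Action n W

section Semantics

variable {n : ℕ} {W : Type*} [NormedAddCommGroup W] [InnerProductSpace ℂ W]

/-- The control that remains after a first step with outcome `i`. -/
def Control.after (A : Control n W) (i : ℕ) : Control n W := fun h => A (i :: h)

/-- The probability that the control `A`, started in the (subnormalised) state `ψ` with hidden
string `x`, halts with output `y` after fewer than `t` query and measurement steps. -/
noncomputable def outputProbWithin (x y : Fin n → Bool) :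
    ℕ → Control n W → State n W → ℝ≥0∞
  | 0, _, _ => 0
  | t + 1, A, ψ =>
    match A [] with
    | .output z => if z = y then ENNReal.ofReal (‖ψ‖ ^ 2) else 0
    | .query => outputProbWithin x y t (A.after 0) (oracle x ψ)
    | .measure m K _ => ∑ i : Fin m, outputProbWithin x y t (A.after i) (K i ψ)

/-- The expected number of queries that the control `A`, started in the (subnormalised) state `ψ`
with hidden string `x`, makes among its first `t` steps. -/
noncomputable def expectedQueriesWithin (x : Fin n → Bool) :
    ℕ → Control n W → State n W → ℝ≥0∞
  | 0, _, _ => 0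
  | t + 1, A, ψ =>
    match A [] with
    | .output _ => 0
    | .query =>
        ENNReal.ofReal (‖ψ‖ ^ 2) + expectedQueriesWithin x t (A.after 0) (oracle x ψ)
    | .measure m K _ => ∑ i : Fin m, expectedQueriesWithin x t (A.after i) (K i ψ)

end Semantics

/-- A quantum query algorithm with workspace `W` in the wildcard query model on `n`-bit strings:
a unit initial vector and a classical control. -/
structure Algorithm (n : ℕ) (W : Type*) [NormedAddCommGroup W] [InnerProductSpace ℂ W] where
  init : State n W
  norm_init : ‖init‖ = 1
  control : Control n W

section Quantities

variable {n : ℕ} {W : Type*} [NormedAddCommGroup W] [InnerProductSpace ℂ W]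

/-- The probability that the algorithm halts and outputs the hidden string `x`. -/
noncomputable def Algorithm.successProb (A : Algorithm n W) (x : Fin n → Bool) : ℝ≥0∞ :=
  ⨆ t : ℕ, outputProbWithin x x t A.control A.init

/-- The expected number of queries that the algorithm makes on the hidden string `x`. -/
noncomputable def Algorithm.expectedQueries (A : Algorithm n W) (x : Fin n → Bool) : ℝ≥0∞ :=
  ⨆ t : ℕ, expectedQueriesWithin x t A.control A.init

end Quantities

end WildcardSearch

/-!
**Lower bound.** This is the adversary argument over the edges `{x, x ⊕ i}` of the hypercube. The
inner products of the states for neighbouring inputs add up to `n * 2 ^ n` at the start, are not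
changed by operations that do not depend on the input, and must lose a constant fraction of this by
the time the algorithm halts, since an output is wrong for at least one end of every edge. A query
loses inner product only where the replies differ. A reply `1` on `x` may differ from the replies on
all `n` neighbours of `x`, but a reply `0` differs from the reply on at most one neighbour; weighting
the two sides by `1/√n` and `√n`, one query loses at most `2√n` per input. The induction in
`adversary_inequality` keeps track of squared norms, and so bounds expected numbers of queries.

**Upper bound.** Everything but the oracle can be described by the Gram matrix of the states for the
different inputs: two families with the same Gram matrix are related by an isometry
(`exists_linearIsometry_of_inner_eq`), and a query followed by a measurement of the answer splits a
Gram matrix according to the replies (`Solves.query`). The algorithm passes through the matrices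
`prefixGram n k`, which belong to the superposition over all orders `π` of the positions of the first
`k` bits of the hidden string in that order; `k = 0` is the start and `k = n` is perfect
distinguishability. From `k` to `N` it goes as follows. For a fixed `N`-element set of positions, the
superposition of all its `k`-element subsets with the bits of `x` there is, in the Fourier basis, a
superposition of characters of `x` with weights `subsetWeight k`. The pretty good measurement guesses
the `N` bits with error amplitudes `amplitude (subsetWeight k)`, whose Fourier transform is the square
root of these weights, and makes `N / 2 - E √((k - m) * (N - m))` errors in expectation, where `m` is
binomial with parameters `k` and `1 / 2`; this is at most `(N - k) ^ 2 / (k + 1)`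
(`exists_amplitude`). The errors are then found by binary search, with wildcard queries that test
whether the guess is right on a set of positions: one query for the whole guess, and about
`2 * log₂ n` for each error (`Searchable.binarySearch`). What is measured is the location of the errors relative to the order
`π`, which reveals nothing about `π` and `x`, so the coherent superposition survives
(`guessGram_singleton`). Taking squares for `k`, each of about `√n` rounds has at most `5` expected
errors.
-/

namespace WildcardSearch

/-! ### Loss of inner product caused by one query -/

section Norms

variable {n : ℕ} {W : Type*} [NormedAddCommGroup W]

lemma norm_oracle (x : Fin n → Bool) (ψ : State n W) : ‖oracle x ψ‖ = ‖ψ‖ := by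
  have h : ‖oracle x ψ‖ ^ 2 = ‖ψ‖ ^ 2 := by
    rw [PiLp.norm_sq_eq_of_L2, PiLp.norm_sq_eq_of_L2, Fintype.sum_prod_type, Fintype.sum_prod_type]
    refine Finset.sum_congr rfl fun q _ => ?_
    rw [Fintype.sum_bool, Fintype.sum_bool]
    cases h : reply x q <;> simp [oracle, h, add_comm]
  exact (sq_eq_sq₀ (norm_nonneg _) (norm_nonneg _)).1 h

/-- The squared norm of the part of a state that asks the query `q`. -/
noncomputable def queryMass (ψ : State n W) (q : Query n) : ℝ :=
  ‖ψ (q, true)‖ ^ 2 + ‖ψ (q, false)‖ ^ 2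

lemma queryMass_nonneg (ψ : State n W) (q : Query n) : 0 ≤ queryMass ψ q := by
  unfold queryMass; positivity

lemma sum_queryMass (ψ : State n W) : ∑ q, queryMass ψ q = ‖ψ‖ ^ 2 := by
  rw [PiLp.norm_sq_eq_of_L2, Fintype.sum_prod_type]
  exact Finset.sum_congr rfl fun q _ => by rw [Fintype.sum_bool, queryMass]

/-- The string `x` with bit `i` flipped. -/
def flipBit (x : Fin n → Bool) (i : Fin n) : Fin n → Bool := Function.update x i (!x i)

lemma flipBit_flipBit (x : Fin n → Bool) (i : Fin n) : flipBit (flipBit x i) i = x := by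
  simp [flipBit]

lemma flipBit_ne (x : Fin n → Bool) (i : Fin n) : flipBit x i ≠ x := fun h => by
  have := congrFun h i
  simp [flipBit] at this

lemma sum_flipBit (i : Fin n) (g : (Fin n → Bool) → ℝ) : ∑ x, g (flipBit x i) = ∑ x, g x :=
  Fintype.sum_equiv (Function.Involutive.toPerm (fun x => flipBit x i)
    (fun x => flipBit_flipBit x i)) _ _ fun _ => rfl

/-- A query with reply `0` on `x` has another reply on at most one neighbour of `x`. -/
lemma card_flipBit_le_one {x : Fin n → Bool} {q : Query n} (h : reply x q = false) :
    (Finset.univ.filter fun i => reply x q ≠ reply (flipBit x i) q).card ≤ 1 := by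
  have h' : ∃ k : q.1, x k ≠ q.2 k := by
    simpa [reply] using h
  obtain ⟨k, hk⟩ := h'
  refine Finset.card_le_one.2 ?_
  have aux : ∀ i, reply x q ≠ reply (flipBit x i) q → i = k := by
    intro i hi
    have : reply (flipBit x i) q = true := by simpa [h] using hi.symm
    have h2 := (of_decide_eq_true this) k
    by_contra hne
    apply hk
    rw [← h2, flipBit, Function.update_of_ne (Ne.symm hne)]
  intro i hi j hj
  rw [Finset.mem_filter] at hi hj
  rw [aux i hi.2, aux j hj.2]

/-- The weights `1/√n` for reply `1` and `√n` for reply `0` balance the two sides of the adversary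
argument: a reply `1` separates `x` from at most `n` neighbours, a reply `0` from at most one. -/
lemma sum_oracle_loss_le (hn : 0 < n) (ψ : (Fin n → Bool) → State n W) {w : Bool → ℝ}
    (hw : w = fun b => if b then (√n)⁻¹ else √n) :
    ∑ x, ∑ i, ∑ q, (if reply x q ≠ reply (flipBit x i) q then
      w (reply x q) * queryMass (ψ x) q +
        w (reply (flipBit x i) q) * queryMass (ψ (flipBit x i)) q else 0) ≤
    2 * √n * ∑ x, ‖ψ x‖ ^ 2 := by
  have hs : 0 < √(n : ℝ) := Real.sqrt_pos.2 (by exact_mod_cast hn)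
  have hss : √(n : ℝ) * √n = n := Real.mul_self_sqrt (by positivity)
  set g : (Fin n → Bool) → Fin n → ℝ := fun x i => ∑ q,
    if reply x q ≠ reply (flipBit x i) q then w (reply x q) * queryMass (ψ x) q else 0 with hg
  have h1 : ∀ x i, (∑ q, (if reply x q ≠ reply (flipBit x i) q then
      w (reply x q) * queryMass (ψ x) q +
        w (reply (flipBit x i) q) * queryMass (ψ (flipBit x i)) q else 0)) =
      g x i + g (flipBit x i) i := by
    intro x i
    simp only [hg, ← Finset.sum_add_distrib, flipBit_flipBit]
    refine Finset.sum_congr rfl fun q _ => ?_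
    by_cases h : reply x q = reply (flipBit x i) q
    · simp [h]
    · simp [h, Ne.symm h]
  simp only [h1]
  have h2 : ∑ x, ∑ i, (g x i + g (flipBit x i) i) = 2 * ∑ x, ∑ i, g x i := by
    rw [Finset.sum_comm]
    simp only [Finset.sum_add_distrib]
    simp only [fun i => sum_flipBit i fun x => g x i]
    rw [Finset.sum_comm, two_mul]
  rw [h2, mul_assoc]
  refine mul_le_mul_of_nonneg_left ?_ (by norm_num)
  rw [Finset.mul_sum]
  refine Finset.sum_le_sum fun x _ => ?_
  rw [hg, Finset.sum_comm, ← sum_queryMass, Finset.mul_sum]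
  refine Finset.sum_le_sum fun q _ => ?_
  rw [← Finset.sum_filter, Finset.sum_const, nsmul_eq_mul, ← mul_assoc]
  refine mul_le_mul_of_nonneg_right ?_ (queryMass_nonneg _ _)
  cases h : reply x q
  · have := card_flipBit_le_one h
    rw [h] at this
    have h' : ((Finset.univ.filter fun i => false ≠ reply (flipBit x i) q).card : ℝ) ≤ 1 := by
      exact_mod_cast this
    simp only [hw]
    simpa using mul_le_mul_of_nonneg_right h' hs.le
  · have h' : ((Finset.univ.filter fun i => true ≠ reply (flipBit x i) q).card : ℝ) ≤ n := by
      exact_mod_cast (Finset.card_le_univ _).trans_eq (by simp)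
    simp only [hw, if_true]
    refine (mul_le_mul_of_nonneg_right h' (by positivity)).trans_eq ?_
    field_simp
    linarith

end Norms

/-! ### The lower bound -/

section LowerBound

variable {n : ℕ} {W : Type*} [NormedAddCommGroup W] [InnerProductSpace ℂ W]

lemma outputProbWithin_le (x y : Fin n → Bool) (t : ℕ) (A : Control n W) (ψ : State n W) :
    outputProbWithin x y t A ψ ≤ ENNReal.ofReal (‖ψ‖ ^ 2) := by
  induction t generalizing A ψ with
  | zero => simp [outputProbWithin]
  | succ t ih =>
    rw [outputProbWithin]
    split
    · split_ifs <;> simp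
    · exact (ih _ _).trans_eq (by rw [norm_oracle])
    · rename_i m K hK _
      refine (Finset.sum_le_sum fun i _ => ih _ _).trans_eq ?_
      rw [← hK ψ, ENNReal.ofReal_sum_of_nonneg fun i _ => sq_nonneg _]

lemma outputProbWithin_ne_top (x y : Fin n → Bool) (t : ℕ) (A : Control n W) (ψ : State n W) :
    outputProbWithin x y t A ψ ≠ ∞ :=
  ((outputProbWithin_le x y t A ψ).trans_lt ENNReal.ofReal_lt_top).ne

lemma outputProbWithin_mono (x y : Fin n → Bool) (A : Control n W) (ψ : State n W) :
    Monotone fun t => outputProbWithin x y t A ψ := by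
  refine monotone_nat_of_le_succ fun t => ?_
  induction t generalizing A ψ with
  | zero => simp [outputProbWithin]
  | succ t ih =>
    rw [outputProbWithin, outputProbWithin]
    split
    · exact le_rfl
    · exact ih _ _
    · exact Finset.sum_le_sum fun i _ => ih _ _

lemma expectedQueriesWithin_ne_top (x : Fin n → Bool) (t : ℕ) (A : Control n W) (ψ : State n W) :
    expectedQueriesWithin x t A ψ ≠ ∞ := by
  induction t generalizing A ψ with
  | zero => simp [expectedQueriesWithin]
  | succ t ih =>
    rw [expectedQueriesWithin]
    split
    · simp
    · exact ENNReal.add_ne_top.2 ⟨ENNReal.ofReal_ne_top, ih _ _⟩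
    · exact ENNReal.sum_ne_top.2 fun i _ => ih _ _

/-- The measurement operators of one step, applied to two states, preserve their inner product
in total: the polarised form of the completeness relation. -/
lemma sum_inner_eq {m : ℕ} {K : Fin m → (State n W →ₗ[ℂ] State n W)}
    (hK : ∀ ψ : State n W, ∑ i, ‖K i ψ‖ ^ 2 = ‖ψ‖ ^ 2) (u v : State n W) :
    ∑ i, (inner ℂ (K i u) (K i v)).re = (inner ℂ u v).re := by
  have e : ∀ a b : State n W, (inner ℂ a b).re = (‖a + b‖ ^ 2 - ‖a‖ ^ 2 - ‖b‖ ^ 2) / 2 := by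
    intro a b
    have := @norm_add_sq ℂ _ _ _ _ a b
    simp only [RCLike.re_eq_complex_re] at this
    linarith
  simp only [e, ← map_add]
  rw [← Finset.sum_div, Finset.sum_sub_distrib, Finset.sum_sub_distrib, hK, hK, hK]

lemma re_inner_le_weighted {E : Type*} [NormedAddCommGroup E] [InnerProductSpace ℂ E] (u v : E)
    {α β : ℝ} (hα : 0 < α) (h : 1 ≤ α * β) :
    |(inner ℂ u v).re| ≤ (α * ‖u‖ ^ 2 + β * ‖v‖ ^ 2) / 2 := by
  have h1 : |(inner ℂ u v).re| ≤ ‖u‖ * ‖v‖ :=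
    (Complex.abs_re_le_norm _).trans (norm_inner_le_norm u v)
  have h2 : α⁻¹ ≤ β := by rw [inv_le_iff_one_le_mul₀ hα, mul_comm]; exact h
  have h3 : α⁻¹ * ‖v‖ ^ 2 ≤ β * ‖v‖ ^ 2 := by gcongr
  have h4 : 0 ≤ α * (‖u‖ - α⁻¹ * ‖v‖) ^ 2 := by positivity
  have h5 : α * (‖u‖ - α⁻¹ * ‖v‖) ^ 2 = α * ‖u‖ ^ 2 - 2 * (‖u‖ * ‖v‖) + α⁻¹ * ‖v‖ ^ 2 := by
    field_simp
    ring
  linarith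

/-- One query decreases the inner product of the states for `x` and `y` only through queries
answered differently on `x` and on `y`. -/
lemma re_inner_le_oracle (x y : Fin n → Bool) (u v : State n W) (w : Bool → ℝ)
    (hw : ∀ b, 0 < w b) (hw1 : w true * w false = 1) :
    (inner ℂ u v).re ≤ (inner ℂ (oracle x u) (oracle y v)).re +
      ∑ q, if reply x q ≠ reply y q then
        w (reply x q) * queryMass u q + w (reply y q) * queryMass v q else 0 := by
  rw [PiLp.inner_apply, PiLp.inner_apply, Fintype.sum_prod_type, Fintype.sum_prod_type,
    Complex.re_sum, Complex.re_sum, ← Finset.sum_add_distrib]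
  refine Finset.sum_le_sum fun q _ => ?_
  rw [Fintype.sum_bool, Fintype.sum_bool]
  have key : ∀ b c : Bool, b ≠ c → ∀ i j : Bool,
      |(inner ℂ (u (q, i)) (v (q, j))).re| ≤ (w b * ‖u (q, i)‖ ^ 2 + w c * ‖v (q, j)‖ ^ 2) / 2 := by
    intro b c hbc i j
    refine re_inner_le_weighted _ _ (hw b) (le_of_eq ?_)
    cases b <;> cases c <;> simp_all [mul_comm]
  cases hx : reply x q <;> cases hy : reply y q
  · simp [oracle, hx, hy]
  · have h1 := abs_le.1 (key false true (by simp) true true)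
    have h2 := abs_le.1 (key false true (by simp) false false)
    have h3 := abs_le.1 (key false true (by simp) true false)
    have h4 := abs_le.1 (key false true (by simp) false true)
    simp only [oracle, hx, hy, Complex.add_re, queryMass]
    simp
    linarith
  · have h1 := abs_le.1 (key true false (by simp) true true)
    have h2 := abs_le.1 (key true false (by simp) false false)
    have h3 := abs_le.1 (key true false (by simp) true false)
    have h4 := abs_le.1 (key true false (by simp) false true)
    simp only [oracle, hx, hy, Complex.add_re, queryMass]
    simp
    linarith
  · simp [oracle, hx, hy, add_comm]

/-- The total inner product of neighbouring inputs drops by at most `2 * √n` per query and unit of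
squared norm. -/
lemma sum_re_inner_le_oracle (hn : 0 < n) (ψ : (Fin n → Bool) → State n W) :
    ∑ x, ∑ i, (inner ℂ (ψ x) (ψ (flipBit x i))).re ≤
      ∑ x, ∑ i, (inner ℂ (oracle x (ψ x)) (oracle (flipBit x i) (ψ (flipBit x i)))).re +
      2 * √n * ∑ x, ‖ψ x‖ ^ 2 := by
  have hs : 0 < √(n : ℝ) := Real.sqrt_pos.2 (by exact_mod_cast hn)
  obtain ⟨w, hw⟩ : ∃ w : Bool → ℝ, w = fun b => if b then (√n)⁻¹ else √n := ⟨_, rfl⟩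
  have hpos : ∀ b, 0 < w b := fun b => by cases b <;> simp [hw, hn]
  have hone : w true * w false = 1 := by simp [hw, hs.ne']
  refine le_trans ?_ (add_le_add le_rfl (sum_oracle_loss_le hn ψ hw))
  simp only [← Finset.sum_add_distrib]
  exact Finset.sum_le_sum fun x _ => Finset.sum_le_sum fun i _ =>
    re_inner_le_oracle x (flipBit x i) _ _ w hpos hone

lemma sum_re_inner_le (ψ : (Fin n → Bool) → State n W) (α : (Fin n → Bool) → ℝ)
    (hα : ∀ x, 0 < α x) (h : ∀ x i, 1 ≤ α x * α (flipBit x i)) :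
    ∑ x, ∑ i, (inner ℂ (ψ x) (ψ (flipBit x i))).re ≤ n * ∑ x, α x * ‖ψ x‖ ^ 2 := by
  have h1 : ∑ x, ∑ i, (inner ℂ (ψ x) (ψ (flipBit x i))).re ≤ ∑ x, ∑ i : Fin n,
      (α x * ‖ψ x‖ ^ 2 + α (flipBit x i) * ‖ψ (flipBit x i)‖ ^ 2) / 2 :=
    Finset.sum_le_sum fun x _ => Finset.sum_le_sum fun i _ =>
      (le_abs_self _).trans (re_inner_le_weighted _ _ (hα x) (h x i))
  refine h1.trans_eq ?_
  rw [Finset.sum_comm]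
  simp only [← Finset.sum_div, Finset.sum_add_distrib]
  simp only [fun i => sum_flipBit i fun x => α x * ‖ψ x‖ ^ 2]
  rw [Finset.sum_const, Finset.card_univ, Fintype.card_fin, nsmul_eq_mul]
  ring

/-- The adversary inequality. Summed over the edges of the hypercube, the inner products of the
states of neighbouring inputs are paid for by the queries and by the final failure probability:
a branch that halts with the right output for one end of an edge is wrong for the other end. -/
lemma adversary_inequality (hn : 0 < n) {μ : ℝ} (hμ : 0 < μ) (hμ1 : μ ≤ 1) (t : ℕ)
    (A : Control n W) (ψ : (Fin n → Bool) → State n W) :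
    ∑ x, ∑ i, (inner ℂ (ψ x) (ψ (flipBit x i))).re ≤
      2 * √n * ∑ x, (expectedQueriesWithin x t A (ψ x)).toReal +
      n * ∑ x, (μ⁻¹ * ‖ψ x‖ ^ 2 - (μ⁻¹ - μ) * (outputProbWithin x x t A (ψ x)).toReal) := by
  have hμ2 : 1 ≤ μ⁻¹ := (one_le_inv₀ hμ).2 hμ1
  induction t generalizing A ψ with
  | zero =>
    have := sum_re_inner_le ψ (fun _ => μ⁻¹) (fun _ => by positivity) (fun _ _ => by nlinarith)
    simpa [outputProbWithin, expectedQueriesWithin] using this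
  | succ t ih =>
    simp only [outputProbWithin, expectedQueriesWithin]
    cases hA : A [] with
    | output z =>
      have := sum_re_inner_le ψ (fun x => if z = x then μ else μ⁻¹)
        (fun x => by split_ifs <;> positivity) (fun x i => by
          split_ifs with h1 h2 h2
          · exact absurd (h2.symm.trans h1) (flipBit_ne x i)
          · rw [mul_inv_cancel₀ hμ.ne']
          · rw [inv_mul_cancel₀ hμ.ne']
          · nlinarith)
      refine this.trans_eq ?_
      simp only [ENNReal.toReal_zero, Finset.sum_const_zero, mul_zero, zero_add]
      congr 1
      refine Finset.sum_congr rfl fun x _ => ?_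
      split_ifs
      · rw [ENNReal.toReal_ofReal (sq_nonneg _)]; ring
      · simp
    | query =>
      dsimp only
      have h0 := ih (A.after 0) fun x => oracle x (ψ x)
      have h2 := sum_re_inner_le_oracle hn ψ
      have h3 : ∀ x, (ENNReal.ofReal (‖ψ x‖ ^ 2) +
          expectedQueriesWithin x t (A.after 0) (oracle x (ψ x))).toReal = ‖ψ x‖ ^ 2 +
          (expectedQueriesWithin x t (A.after 0) (oracle x (ψ x))).toReal := fun x => by
        rw [ENNReal.toReal_add ENNReal.ofReal_ne_top (expectedQueriesWithin_ne_top _ _ _ _),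
          ENNReal.toReal_ofReal (sq_nonneg _)]
      simp only [norm_oracle] at h0
      simp only [h3, Finset.sum_add_distrib (f := fun x => ‖ψ x‖ ^ 2)]
      linarith
    | measure m K hK =>
      dsimp only
      have h0 := Finset.sum_le_sum fun (j : Fin m) (_ : j ∈ Finset.univ) =>
        ih (A.after j) fun x => K j (ψ x)
      have e1 : ∀ x, (∑ j : Fin m, expectedQueriesWithin x t (A.after j) (K j (ψ x))).toReal =
          ∑ j : Fin m, (expectedQueriesWithin x t (A.after j) (K j (ψ x))).toReal := fun x =>
        ENNReal.toReal_sum fun j _ => expectedQueriesWithin_ne_top _ _ _ _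
      have e2 : ∀ x, (∑ j : Fin m, outputProbWithin x x t (A.after j) (K j (ψ x))).toReal =
          ∑ j : Fin m, (outputProbWithin x x t (A.after j) (K j (ψ x))).toReal := fun x =>
        ENNReal.toReal_sum fun j _ => outputProbWithin_ne_top _ _ _ _ _
      simp only [e1, e2]
      calc _ = ∑ j : Fin m, ∑ x, ∑ i, (inner ℂ (K j (ψ x)) (K j (ψ (flipBit x i)))).re := by
            symm
            rw [Finset.sum_comm]
            refine Finset.sum_congr rfl fun x _ => ?_
            rw [Finset.sum_comm]
            exact Finset.sum_congr rfl fun i _ => sum_inner_eq hK _ _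
        _ ≤ _ := h0
        _ = _ := by
            rw [Finset.sum_add_distrib, ← Finset.mul_sum, ← Finset.mul_sum, Finset.sum_comm]
            congr 2
            rw [Finset.sum_comm]
            refine Finset.sum_congr rfl fun x _ => ?_
            rw [Finset.sum_sub_distrib, ← Finset.mul_sum, ← Finset.mul_sum, hK]

theorem lower_bound {ε : ℝ} (hε : 0 ≤ ε) (hε2 : ε < 1 / 2) :
    ∃ c : ℝ, 0 < c ∧ ∀ (n : ℕ) (W : Type*) [NormedAddCommGroup W] [InnerProductSpace ℂ W]
      (A : Algorithm n W), (∀ x : Fin n → Bool, ENNReal.ofReal (1 - ε) ≤ A.successProb x) →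
      ∃ x : Fin n → Bool, ENNReal.ofReal (c * √n) ≤ A.expectedQueries x := by
  -- A run is cut off at a finite time at which every input succeeds with probability `1 - δ`.
  obtain ⟨δ, hδ1, hδ2⟩ := exists_between hε2
  have hβ : 0 < 1 / 2 - 2 * (δ * (1 - δ)) := by nlinarith [sq_pos_of_pos (sub_pos.2 hδ2)]
  refine ⟨(1 / 2 - 2 * (δ * (1 - δ))) / 2, by positivity, fun n W _ _ A hA => ?_⟩
  rcases Nat.eq_zero_or_pos n with rfl | hn
  · exact ⟨default, by simp⟩
  have hex : ∀ x, ∃ t, ENNReal.ofReal (1 - δ) < outputProbWithin x x t A.control A.init :=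
    fun x => lt_iSup_iff.1 (((ENNReal.ofReal_lt_ofReal_iff (by linarith)).2
      (by linarith)).trans_le (hA x))
  choose T hT using hex
  set t := Finset.univ.sup T
  have hp : ∀ x, 1 - δ ≤ (outputProbWithin x x t A.control A.init).toReal := fun x =>
    (ENNReal.ofReal_le_iff_le_toReal (outputProbWithin_ne_top _ _ _ _ _)).1
      ((hT x).le.trans (outputProbWithin_mono x x _ _ (Finset.le_sup (Finset.mem_univ x))))
  -- This `μ` lies between `δ / (1 - δ)` and `1`, where `δ / μ + (1 - δ) * μ < 1`.
  set μ : ℝ := (2 * (1 - δ))⁻¹ with hμ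
  have hd : 0 < 2 * (1 - δ) := by linarith
  have hμ0 : 0 < μ := inv_pos.2 hd
  have hμ1 : μ ≤ 1 := inv_le_one_of_one_le₀ (by linarith)
  have key := adversary_inequality hn hμ0 hμ1 t A.control fun _ => A.init
  simp only [inner_self_eq_norm_sq_to_K, A.norm_init] at key
  have hleaf : ∀ x, μ⁻¹ * 1 ^ 2 - (μ⁻¹ - μ) *
      (outputProbWithin x x t A.control A.init).toReal ≤ 1 / 2 + 2 * (δ * (1 - δ)) := by
    intro x
    have h1 : 0 ≤ μ⁻¹ - μ := by linarith [(one_le_inv₀ hμ0).2 hμ1]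
    have h2 := mul_le_mul_of_nonneg_left (hp x) h1
    have h3 : μ * (1 - δ) = 1 / 2 := by
      have : 1 - δ ≠ 0 := by linarith
      rw [hμ]; field_simp
    have h4 : μ⁻¹ = 2 * (1 - δ) := by rw [hμ, inv_inv]
    rw [h4] at h2 ⊢
    nlinarith
  have hsum := Finset.sum_le_sum fun x (_ : x ∈ Finset.univ) => hleaf x
  rw [Finset.sum_const, nsmul_eq_mul] at hsum
  simp only [Finset.sum_const, nsmul_eq_mul, Finset.card_univ, Fintype.card_fin] at key hsum
  set N : ℝ := (Fintype.card (Fin n → Bool) : ℝ)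
  have hs : 0 < √(n : ℝ) := Real.sqrt_pos.2 (by exact_mod_cast hn)
  have hss : √(n : ℝ) * √n = n := Real.mul_self_sqrt (by positivity)
  have hn' : (0 : ℝ) < n := by exact_mod_cast hn
  have key2 : N * ((1 / 2 - 2 * (δ * (1 - δ))) / 2 * √n) ≤
      ∑ x, (expectedQueriesWithin x t A.control A.init).toReal := by
    have h1 : N * n ≤ 2 * √n * ∑ x, (expectedQueriesWithin x t A.control A.init).toReal +
        n * (N * (1 / 2 + 2 * (δ * (1 - δ)))) := by
      refine le_trans (le_of_eq ?_) (key.trans (add_le_add_right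
        (mul_le_mul_of_nonneg_left hsum hn'.le) _))
      simp
    refine le_of_mul_le_mul_left ?_ (by positivity : 0 < 2 * √(n : ℝ))
    have : 2 * √(n : ℝ) * (N * ((1 / 2 - 2 * (δ * (1 - δ))) / 2 * √n)) =
        N * (1 / 2 - 2 * (δ * (1 - δ))) * (√(n : ℝ) * √n) := by ring
    rw [this, hss]
    linarith
  obtain ⟨x, -, hx⟩ := Finset.exists_le_of_sum_le (s := Finset.univ)
    (g := fun x => (expectedQueriesWithin x t A.control A.init).toReal) (f := fun _ : Fin n → Bool => (1 / 2 - 2 * (δ * (1 - δ))) / 2 * √(n : ℝ))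
    Finset.univ_nonempty (by
      rw [Finset.sum_const, nsmul_eq_mul, Finset.card_univ]; exact key2)
  exact ⟨x, ((ENNReal.ofReal_le_iff_le_toReal (expectedQueriesWithin_ne_top _ _ _ _)).2 hx).trans
    (le_iSup (fun t => expectedQueriesWithin x t A.control A.init) t)⟩

end LowerBound

/-! ### Protocols as decompositions of Gram matrices -/

/-- Families of vectors with the same Gram matrix are related by an isometry. -/
lemma exists_linearIsometry_of_inner_eq {X V : Type*} [Fintype X] [NormedAddCommGroup V]
    [InnerProductSpace ℂ V] [FiniteDimensional ℂ V] (u v : X → V)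
    (h : ∀ x y, inner ℂ (u x) (u y) = inner ℂ (v x) (v y)) :
    ∃ U : V →ₗᵢ[ℂ] V, ∀ x, U (u x) = v x := by
  classical
  set S := Fintype.linearCombination ℂ u
  set T := Fintype.linearCombination ℂ v
  have hnorm : ∀ c, ‖T c‖ = ‖S c‖ := by
    intro c
    have h1 : inner ℂ (T c) (T c) = inner ℂ (S c) (S c) := by
      simp only [S, T, Fintype.linearCombination_apply, sum_inner, inner_sum, inner_smul_left,
        inner_smul_right, h]
    rw [@norm_eq_sqrt_re_inner ℂ, h1, ← @norm_eq_sqrt_re_inner ℂ]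
  obtain ⟨s, hs⟩ := S.rangeRestrict.exists_rightInverse_of_surjective S.range_rangeRestrict
  have hs' : ∀ w : LinearMap.range S, S (s w) = w := fun w =>
    congrArg Subtype.val (LinearMap.congr_fun hs w)
  let L : LinearMap.range S →ₗᵢ[ℂ] V := ⟨T ∘ₗ s, fun w => by
    rw [LinearMap.comp_apply, hnorm, hs', Submodule.coe_norm]⟩
  refine ⟨L.extend, fun x => ?_⟩
  have hu : u x = S (Pi.single x 1) := by simp [S]
  have hv : v x = T (Pi.single x 1) := by simp [T]
  have h1 := L.extend_apply ⟨u x, hu ▸ LinearMap.mem_range_self S _⟩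
  refine h1.trans (sub_eq_zero.1 (norm_eq_zero.1 ?_))
  change ‖T (s _) - v x‖ = 0
  rw [hv, ← map_sub, hnorm, map_sub, hs']
  simp only [hu, sub_self, norm_zero]

lemma expectedQueriesWithin_mono {n : ℕ} {W : Type*} [NormedAddCommGroup W]
    [InnerProductSpace ℂ W] (x : Fin n → Bool) (A : Control n W) (ψ : State n W) :
    Monotone fun t => expectedQueriesWithin x t A ψ := by
  refine monotone_nat_of_le_succ fun t => ?_
  induction t generalizing A ψ with
  | zero => simp [expectedQueriesWithin]
  | succ t ih =>
    rw [expectedQueriesWithin, expectedQueriesWithin]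
    split
    · exact le_rfl
    · exact add_le_add le_rfl (ih _ _)
    · exact Finset.sum_le_sum fun i _ => ih _ _

/-- The control that first does `a` and then, after outcome `i`, continues with `next i`. -/
def Control.cons {n : ℕ} {W : Type*} [NormedAddCommGroup W] [InnerProductSpace ℂ W]
    (a : Action n W) (next : ℕ → Control n W) : Control n W
  | [] => a
  | i :: h => next i h

section Protocols

variable {n : ℕ}

/-- The basis of the workspace used for the upper bound: a reordering of the positions and a
string of guessed bits. -/
abbrev WorkIndex (n : ℕ) : Type := Equiv.Perm (Fin n) × (Fin n → Bool)

/-- The workspace used for the upper bound, with orthonormal basis `WorkIndex n`. -/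
abbrev Work (n : ℕ) : Type := EuclideanSpace ℂ (WorkIndex n)

/-- The basis state `|q⟩|z⟩|w⟩`, for `P = (q, z)`. -/
noncomputable def basisState (P : Query n × Bool) (w : WorkIndex n) : State n (Work n) :=
  WithLp.toLp 2 (Pi.single P (EuclideanSpace.single w 1))

lemma inner_basisState (P P' : Query n × Bool) (w w' : WorkIndex n) :
    inner ℂ (basisState P w) (basisState P' w') = if P = P' ∧ w = w' then (1 : ℂ) else 0 := by
  rw [PiLp.inner_apply, Finset.sum_eq_single P]
  · by_cases h : P = P'
    · subst h
      simp [basisState, EuclideanSpace.inner_single_left]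
    · simp [basisState, h]
  · intro Q _ hQ
    simp only [basisState, Pi.single_eq_of_ne hQ, inner_zero_left]
  · simp

/-- The state with real amplitudes `c j` on the basis states with labels `p j` and `e j`. -/
noncomputable def ket {κ : Type*} [Fintype κ] (p : κ → Query n × Bool) (e : κ → WorkIndex n)
    (c : κ → ℝ) : State n (Work n) :=
  ∑ j, (c j : ℂ) • basisState (p j) (e j)

lemma inner_ket {κ : Type*} [Fintype κ] (p : κ → Query n × Bool) {e : κ → WorkIndex n}
    (he : Function.Injective e) (c d : κ → ℝ) :
    inner ℂ (ket p e c) (ket p e d) = ((∑ j, c j * d j : ℝ) : ℂ) := by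
  have ho : Orthonormal ℂ fun j => basisState (p j) (e j) := by
    classical
    rw [orthonormal_iff_ite]
    intro i j
    rw [inner_basisState]
    by_cases h : i = j
    · simp [h]
    · simp [h, he.ne h]
  rw [ket, ket, ho.inner_sum]
  simp

/-- Measurement of the label `l` of the basis states. -/
noncomputable def labelProj {m : ℕ} (l : (Query n × Bool) × WorkIndex n → Fin m) (i : Fin m) :
    State n (Work n) →ₗ[ℂ] State n (Work n) where
  toFun ψ := WithLp.toLp 2 fun P => WithLp.toLp 2 fun w => if l (P, w) = i then ψ P w else 0
  map_add' ψ φ := by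
    ext P w
    simp only [PiLp.add_apply]
    split_ifs <;> simp
  map_smul' a ψ := by
    ext P w
    simp

lemma sum_norm_labelProj {m : ℕ} (l : (Query n × Bool) × WorkIndex n → Fin m)
    (ψ : State n (Work n)) : ∑ i, ‖labelProj l i ψ‖ ^ 2 = ‖ψ‖ ^ 2 := by
  simp only [PiLp.norm_sq_eq_of_L2]
  rw [Finset.sum_comm]
  refine Finset.sum_congr rfl fun P _ => ?_
  rw [Finset.sum_comm]
  refine Finset.sum_congr rfl fun w _ => ?_
  rw [Finset.sum_eq_single (l (P, w))]
  · simp [labelProj]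
  · intro i _ hi
    simp [labelProj, hi.symm]
  · simp

lemma labelProj_basisState {m : ℕ} (l : (Query n × Bool) × WorkIndex n → Fin m) (i : Fin m)
    (P : Query n × Bool) (w : WorkIndex n) :
    labelProj l i (basisState P w) = if l (P, w) = i then basisState P w else 0 := by
  ext Q v
  by_cases h : Q = P
  · subst h
    by_cases h' : v = w
    · subst h'
      split_ifs with h'' <;> simp [labelProj, h'']
    · split_ifs <;> simp [labelProj, basisState, h']
  · split_ifs <;> simp [labelProj, basisState, h]

lemma labelProj_ket {m : ℕ} (l : (Query n × Bool) × WorkIndex n → Fin m) (i : Fin m)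
    {κ : Type*} [Fintype κ] (p : κ → Query n × Bool) (e : κ → WorkIndex n) (c : κ → ℝ) :
    labelProj l i (ket p e c) = ∑ j, if l (p j, e j) = i then
      (c j : ℂ) • basisState (p j) (e j) else 0 := by
  simp only [ket, map_sum, map_smul, labelProj_basisState]
  exact Finset.sum_congr rfl fun j _ => by split_ifs <;> simp

lemma oracle_ket (x : Fin n → Bool) {κ : Type*} [Fintype κ] (q : κ → Query n)
    (e : κ → WorkIndex n) (c : κ → ℝ) :
    oracle x (ket (fun j => (q j, false)) e c) = ket (fun j => (q j, reply x (q j))) e c := by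
  ext ⟨Q, b⟩ w
  simp only [oracle, ket, WithLp.ofLp_sum, Finset.sum_apply, WithLp.ofLp_smul,
    Pi.smul_apply]
  refine Finset.sum_congr rfl fun j _ => ?_
  congr 1
  by_cases h : Q = q j
  · subst h
    cases b <;> cases hr : reply x (q j) <;> simp [basisState]
  · have h1 : ∀ b b', ((Q, b) : Query n × Bool) ≠ (q j, b') := fun b b' h' => h (congrArg Prod.fst h')
    simp only [basisState, Pi.single_eq_of_ne (h1 _ _)]

/-- `Solves G c` says that inputs encoded in states with Gram matrix proportional to `G` can be
found with certainty. If the Gram matrix is `r * G`, then the expected number of queries, weighted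
by the squared norm of the state, is at most `r * c`. -/
def Solves (G : (Fin n → Bool) → (Fin n → Bool) → ℝ) (c : ℝ) : Prop :=
  ∀ r : ℝ, 0 ≤ r → ∀ u : (Fin n → Bool) → State n (Work n),
    (∀ x y, inner ℂ (u x) (u y) = ((r * G x y : ℝ) : ℂ)) →
    ∃ A : Control n (Work n), ∀ x,
      (∃ t₀, ∀ t ≥ t₀, ENNReal.ofReal (‖u x‖ ^ 2) ≤ outputProbWithin x x t A (u x)) ∧
      ∀ t, expectedQueriesWithin x t A (u x) ≤ ENNReal.ofReal (r * c)

variable {G : (Fin n → Bool) → (Fin n → Bool) → ℝ} {c : ℝ}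

lemma Solves.mono (h : Solves G c) {c' : ℝ} (hc : c ≤ c') : Solves G c' := fun r hr u hu => by
  obtain ⟨A, hA⟩ := h r hr u hu
  exact ⟨A, fun x => ⟨(hA x).1, fun t => ((hA x).2 t).trans
    (ENNReal.ofReal_le_ofReal (mul_le_mul_of_nonneg_left hc hr))⟩⟩

lemma Solves.smul (h : Solves G c) {s : ℝ} (hs : 0 ≤ s) :
    Solves (fun x y => s * G x y) (s * c) := fun r hr u hu => by
  obtain ⟨A, hA⟩ := h (r * s) (mul_nonneg hr hs) u fun x y => by rw [hu, mul_assoc]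
  exact ⟨A, fun x => ⟨(hA x).1, fun t => ((hA x).2 t).trans_eq (by rw [mul_assoc])⟩⟩

/-- Orthogonal states need no query. -/
lemma solves_of_diagonal (hG : ∀ x y, x ≠ y → G x y = 0) (hG0 : ∀ x, 0 ≤ G x x) :
    Solves G 0 := by
  classical
  intro r hr u hu
  set p : (Fin n → Bool) → Query n × Bool := fun _ => (⟨∅, fun _ => false⟩, false)
  set e : (Fin n → Bool) → WorkIndex n := fun x => (1, x)
  have he : Function.Injective e := fun x y h => congrArg Prod.snd h
  set v : (Fin n → Bool) → State n (Work n) := fun x =>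
    ket p e fun j => if j = x then √(r * G x x) else 0
  obtain ⟨U, hU⟩ := exists_linearIsometry_of_inner_eq u v fun x y => by
    rw [hu, inner_ket p he]
    by_cases h : x = y
    · subst h
      simp [Real.mul_self_sqrt (mul_nonneg hr (hG0 x))]
    · simp [Ne.symm h, hG x y h]
  set F := Fintype.equivFin (Fin n → Bool)
  set l : (Query n × Bool) × WorkIndex n → Fin (Fintype.card (Fin n → Bool)) := fun a => F a.2.2
  have hproj : ∀ x, labelProj l (F x) (v x) = v x := by
    intro x
    rw [labelProj_ket]
    refine Finset.sum_congr rfl fun j _ => ?_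
    by_cases h : j = x
    · simp [l, e, h]
    · simp [h]
  refine ⟨Control.cons (.measure 1 (fun _ => U.toLinearMap) fun ψ => by simp) fun _ =>
    Control.cons (.measure _ (labelProj l) (sum_norm_labelProj l)) fun i _ =>
      .output (if h : i < _ then F.symm ⟨i, h⟩ else default), fun x => ⟨⟨3, fun t ht => ?_⟩,
      fun t => ?_⟩⟩
  · obtain ⟨t, rfl⟩ := Nat.exists_eq_add_of_le' ht
    simp only [outputProbWithin, Control.cons, Control.after, Finset.univ_unique,
      Finset.sum_singleton, LinearIsometry.coe_toLinearMap, hU]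
    refine le_trans ?_ (Finset.single_le_sum (fun _ _ => zero_le) (Finset.mem_univ (F x)))
    rw [dif_pos (F x).2, Fin.eta, F.symm_apply_apply, if_pos rfl, hproj, ← hU,
      LinearIsometry.norm_map]
  · refine (expectedQueriesWithin_mono x _ _ (Nat.le_add_right t 3)).trans ?_
    simp [expectedQueriesWithin, Control.cons, Control.after]

/-- One query in the language of Gram matrices. If `G` is the Gram matrix of the vectors `f x`,
whose coordinate `j` is labelled by the query `q j`, then a query splits `G` into the Gram matrices
of the parts of `f x` on which the reply is `1` and `0`. -/
lemma Solves.query {κ : Type*} [Fintype κ] {e : κ → WorkIndex n} (he : Function.Injective e)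
    (q : κ → Query n) (f : (Fin n → Bool) → κ → ℝ)
    {G' : Bool → (Fin n → Bool) → (Fin n → Bool) → ℝ} {c : Bool → ℝ} {D : ℝ}
    (hG : ∀ x y, G x y = ∑ j, f x j * f y j)
    (hG' : ∀ b x y, G' b x y =
      ∑ j, if reply x (q j) = b ∧ reply y (q j) = b then f x j * f y j else 0)
    (hD : ∀ x, G x x ≤ D) (hc : ∀ b, 0 ≤ c b) (h : ∀ b, Solves (G' b) (c b)) :
    Solves G (D + (c true + c false)) := by
  classical
  intro r hr u hu
  have hrr : √r * √r = r := Real.mul_self_sqrt hr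
  set v : (Fin n → Bool) → State n (Work n) := fun x =>
    ket (fun j => (q j, false)) e fun j => √r * f x j
  obtain ⟨U, hU⟩ := exists_linearIsometry_of_inner_eq u v fun x y => by
    rw [hu, inner_ket _ he, hG, Finset.mul_sum]
    congr 1
    exact Finset.sum_congr rfl fun j _ => by linear_combination (-f x j * f y j) * hrr
  set v' : Bool → (Fin n → Bool) → State n (Work n) := fun b x =>
    ket (fun j => (q j, b)) e fun j => if reply x (q j) = b then √r * f x j else 0
  have hA : ∀ b, ∃ A : Control n (Work n), ∀ x,
      (∃ t₀, ∀ t ≥ t₀, ENNReal.ofReal (‖v' b x‖ ^ 2) ≤ outputProbWithin x x t A (v' b x)) ∧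
      ∀ t, expectedQueriesWithin x t A (v' b x) ≤ ENNReal.ofReal (r * c b) := fun b =>
    h b r hr (v' b) fun x y => by
      rw [inner_ket _ he, hG', Finset.mul_sum]
      congr 1
      refine Finset.sum_congr rfl fun j _ => ?_
      by_cases h1 : reply x (q j) = b <;> by_cases h2 : reply y (q j) = b <;> simp [h1, h2]
      linear_combination (f x j * f y j) * hrr
  choose A hA using hA
  set l : (Query n × Bool) × WorkIndex n → Fin 2 := fun a => if a.1.2 then 1 else 0
  have hproj : ∀ b x, labelProj l (if b then 1 else 0) (oracle x (v x)) = v' b x := by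
    intro b x
    rw [oracle_ket, labelProj_ket]
    refine Finset.sum_congr rfl fun j _ => ?_
    cases b <;> cases hr : reply x (q j) <;> simp [l, hr]
  have hproj1 : ∀ x, labelProj l 1 (oracle x (v x)) = v' true x := hproj true
  have hproj0 : ∀ x, labelProj l 0 (oracle x (v x)) = v' false x := hproj false
  have hnorm : ∀ x, ‖u x‖ ^ 2 = r * G x x := fun x => by
    rw [@norm_sq_eq_re_inner ℂ, hu]
    exact Complex.ofReal_re _
  have hsum : ∀ x, ‖u x‖ ^ 2 = ‖v' false x‖ ^ 2 + ‖v' true x‖ ^ 2 := fun x => by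
    have := sum_norm_labelProj l (oracle x (v x))
    rw [Fin.sum_univ_two, hproj0, hproj1, norm_oracle, ← hU, LinearIsometry.norm_map] at this
    exact this.symm
  -- Rotate `u` to `v`, query, and measure the answer qubit.
  refine ⟨Control.cons (.measure 1 (fun _ => U.toLinearMap) fun ψ => by simp) fun _ =>
    Control.cons .query fun _ => Control.cons (.measure 2 (labelProj l) (sum_norm_labelProj l))
      fun i => if i = 1 then A true else A false, fun x => ⟨?_, fun t => ?_⟩⟩
  · obtain ⟨t1, h1⟩ := (hA true x).1
    obtain ⟨t0, h0⟩ := (hA false x).1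
    refine ⟨max t0 t1 + 3, fun t ht => ?_⟩
    obtain ⟨s, rfl⟩ := Nat.exists_eq_add_of_le' ht
    have e1 := h1 (s + max t0 t1) (by omega)
    have e0 := h0 (s + max t0 t1) (by omega)
    rw [← add_assoc]
    simp only [outputProbWithin, Control.cons, Control.after, Finset.univ_unique,
      Finset.sum_singleton, LinearIsometry.coe_toLinearMap, hU, Fin.sum_univ_two, hproj0, hproj1]
    rw [hsum, ENNReal.ofReal_add (sq_nonneg _) (sq_nonneg _)]
    exact add_le_add e0 e1
  · refine (expectedQueriesWithin_mono x _ _ (Nat.le_add_right t 3)).trans ?_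
    have e1 := (hA true x).2 t
    have e0 := (hA false x).2 t
    simp only [expectedQueriesWithin, Control.cons, Control.after, Finset.univ_unique,
      Finset.sum_singleton, LinearIsometry.coe_toLinearMap, hU, Fin.sum_univ_two, hproj0, hproj1]
    have hv1 : ‖v x‖ ^ 2 ≤ r * D := by
      rw [← hU, LinearIsometry.norm_map, hnorm]
      exact mul_le_mul_of_nonneg_left (hD x) hr
    have hD0 : 0 ≤ r * D := (sq_nonneg _).trans hv1
    rw [mul_add, mul_add, ENNReal.ofReal_add hD0
      (add_nonneg (mul_nonneg hr (hc _)) (mul_nonneg hr (hc _))),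
      ENNReal.ofReal_add (mul_nonneg hr (hc _)) (mul_nonneg hr (hc _)),
      add_comm (ENNReal.ofReal (r * c true))]
    exact add_le_add (ENNReal.ofReal_le_ofReal hv1) (add_le_add e0 e1)

/-- Indistinguishable states are where an algorithm starts. -/
lemma Solves.exists_algorithm (h : Solves (n := n) (fun _ _ => 1) c) :
    ∃ A : Algorithm n (Work n), ∀ x : Fin n → Bool,
      A.successProb x = 1 ∧ A.expectedQueries x ≤ ENNReal.ofReal c := by
  set φ : State n (Work n) := basisState (⟨∅, fun _ => false⟩, false) (1, fun _ => false)
  have hφ : inner ℂ φ φ = (1 : ℂ) := by rw [inner_basisState]; simp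
  have hφ1 : ‖φ‖ = 1 := by
    rw [@norm_eq_sqrt_re_inner ℂ, hφ]; simp
  obtain ⟨A, hA⟩ := h 1 zero_le_one (fun _ => φ) fun x y => by rw [hφ]; simp
  refine ⟨⟨φ, hφ1, A⟩, fun x => ⟨le_antisymm (iSup_le fun t => ?_) ?_, iSup_le fun t => ?_⟩⟩
  · simpa [hφ1] using outputProbWithin_le x x t A φ
  · obtain ⟨t, ht⟩ := (hA x).1
    refine le_trans ?_ (le_iSup (fun t => outputProbWithin x x t A φ) t)
    simpa [hφ1] using ht t le_rfl
  · simpa using (hA x).2 t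

end Protocols

/-! ### Error amplitudes and their Fourier transform -/

section Fourier

variable {N : ℕ}

/-- The character `e ↦ (-1) ^ (∑ i ∈ s, e i)` of the group of bit strings. -/
def parityChar (s : Finset (Fin N)) (e : Fin N → Bool) : ℝ := ∏ i ∈ s, if e i then -1 else 1

lemma parityChar_xor (s : Finset (Fin N)) (e d : Fin N → Bool) :
    parityChar s (fun i => xor (e i) (d i)) = parityChar s e * parityChar s d := by
  rw [parityChar, parityChar, parityChar, ← Finset.prod_mul_distrib]
  refine Finset.prod_congr rfl fun i _ => ?_
  cases e i <;> cases d i <;> simp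

lemma parityChar_eq_prod_univ (s : Finset (Fin N)) (e : Fin N → Bool) :
    parityChar s e = ∏ i, if i ∈ s then (if e i then (-1 : ℝ) else 1) else 1 := by
  rw [Finset.prod_ite_mem, Finset.univ_inter, parityChar]

lemma parityChar_mul (s t : Finset (Fin N)) (e : Fin N → Bool) :
    parityChar s e * parityChar t e = parityChar (symmDiff s t) e := by
  simp only [parityChar_eq_prod_univ]
  rw [← Finset.prod_mul_distrib]
  refine Finset.prod_congr rfl fun i _ => ?_
  by_cases hs : i ∈ s <;> by_cases ht : i ∈ t <;> cases e i <;>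
    simp [Finset.mem_symmDiff, hs, ht]

lemma sum_parityChar (s : Finset (Fin N)) :
    ∑ e, parityChar s e = if s = ∅ then (2 : ℝ) ^ N else 0 := by
  simp only [parityChar_eq_prod_univ]
  have h := Finset.prod_univ_sum (fun _ : Fin N => (Finset.univ : Finset Bool))
    (fun i b => if i ∈ s then (if b then (-1 : ℝ) else 1) else 1)
  rw [Fintype.piFinset_univ] at h
  rw [← h]
  split_ifs with hs
  · subst hs
    simp
  · obtain ⟨i, hi⟩ := Finset.nonempty_iff_ne_empty.2 hs
    exact Finset.prod_eq_zero (Finset.mem_univ i) (by simp [hi])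

lemma parseval (α β : Finset (Fin N) → ℝ) :
    ∑ e, (∑ s, α s * parityChar s e) * (∑ t, β t * parityChar t e) =
      2 ^ N * ∑ s, α s * β s := by
  simp only [Finset.sum_mul_sum]
  rw [Finset.sum_comm, Finset.mul_sum]
  refine Finset.sum_congr rfl fun s _ => ?_
  rw [Finset.sum_comm, Finset.sum_eq_single s]
  · calc _ = ∑ e : Fin N → Bool, α s * β s * parityChar (symmDiff s s) e :=
          Finset.sum_congr rfl fun e _ => by rw [← parityChar_mul]; ring
      _ = _ := by rw [← Finset.mul_sum, sum_parityChar, symmDiff_self]; simp; ring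
  · intro t _ hts
    calc _ = ∑ e : Fin N → Bool, α s * β t * parityChar (symmDiff s t) e :=
          Finset.sum_congr rfl fun e _ => by rw [← parityChar_mul]; ring
      _ = _ := by
          rw [← Finset.mul_sum, sum_parityChar, if_neg, mul_zero]
          rw [← Finset.bot_eq_empty, symmDiff_eq_bot]
          exact hts.symm
  · simp

lemma sum_powerset_parityChar (T : Finset (Fin N)) (d : Fin N → Bool) :
    ∑ s ∈ T.powerset, parityChar s d = if ∀ i ∈ T, d i = false then (2 : ℝ) ^ T.card else 0 := by
  simp only [parityChar]
  rw [← Finset.prod_one_add]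
  split_ifs with h
  · rw [Finset.prod_congr rfl fun i hi => by rw [h i hi], Finset.prod_const]
    norm_num
  · push Not at h
    obtain ⟨i, hi, hd⟩ := h
    exact Finset.prod_eq_zero hi (by simp [hd])

/-- The function on bit strings whose Fourier transform is the square root of `p`: it describes the
errors of the pretty good measurement for states with Gram matrix `∑ s, p s * χ_s (x ⊕ y)`. -/
noncomputable def amplitude (p : Finset (Fin N) → ℝ) (e : Fin N → Bool) : ℝ :=
  (√(2 ^ N))⁻¹ * ∑ s, √(p s) * parityChar s e

lemma sum_symmDiff (u : Finset (Fin N)) (g : Finset (Fin N) → ℝ) :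
    ∑ s, g (symmDiff s u) = ∑ s, g s :=
  Fintype.sum_equiv ⟨fun s => symmDiff s u, fun s => symmDiff s u,
    fun s => symmDiff_symmDiff_cancel_right u s, fun s => symmDiff_symmDiff_cancel_right u s⟩
    _ _ fun _ => rfl

lemma sq_inv_sqrt_two_pow (N : ℕ) : (√(2 ^ N : ℝ))⁻¹ * (√(2 ^ N))⁻¹ * 2 ^ N = 1 := by
  rw [← mul_inv, Real.mul_self_sqrt (by positivity), inv_mul_cancel₀ (by positivity)]

lemma sum_amplitude_mul_amplitude_xor {p : Finset (Fin N) → ℝ} (hp : ∀ s, 0 ≤ p s)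
    (d : Fin N → Bool) :
    ∑ e, amplitude p e * amplitude p (fun i => xor (e i) (d i)) = ∑ s, p s * parityChar s d := by
  have h := parseval (fun s => √(p s)) fun s => √(p s) * parityChar s d
  calc _ = (√(2 ^ N : ℝ))⁻¹ * (√(2 ^ N))⁻¹ * ∑ e : Fin N → Bool,
        (∑ s, √(p s) * parityChar s e) * (∑ t, √(p t) * parityChar t d * parityChar t e) := by
        rw [Finset.mul_sum]
        refine Finset.sum_congr rfl fun e _ => ?_
        simp only [amplitude, parityChar_xor, mul_right_comm _ (parityChar _ d),
          ← mul_assoc (√ _)]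
        ring
    _ = _ := by
        rw [h, ← mul_assoc, sq_inv_sqrt_two_pow, one_mul]
        exact Finset.sum_congr rfl fun s _ => by rw [← mul_assoc, Real.mul_self_sqrt (hp s)]

lemma sum_sq_amplitude_mul_parityChar (p : Finset (Fin N) → ℝ) (u : Finset (Fin N)) :
    ∑ e, amplitude p e ^ 2 * parityChar u e = ∑ s, √(p s) * √(p (symmDiff s u)) := by
  have h := parseval (fun s => √(p s)) fun s => √(p (symmDiff s u))
  have h1 : ∀ e : Fin N → Bool, parityChar u e * ∑ s, √(p s) * parityChar s e =
      ∑ s, √(p (symmDiff s u)) * parityChar s e := by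
    intro e
    rw [Finset.mul_sum, ← sum_symmDiff u fun s => √(p (symmDiff s u)) * parityChar s e]
    refine Finset.sum_congr rfl fun s _ => ?_
    rw [symmDiff_symmDiff_cancel_right, ← parityChar_mul]
    ring
  calc _ = (√(2 ^ N : ℝ))⁻¹ * (√(2 ^ N))⁻¹ * ∑ e : Fin N → Bool,
        (∑ s, √(p s) * parityChar s e) * (∑ t, √(p (symmDiff t u)) * parityChar t e) := by
        rw [Finset.mul_sum]
        refine Finset.sum_congr rfl fun e _ => ?_
        rw [← h1, amplitude]
        ring
    _ = _ := by rw [h, ← mul_assoc, sq_inv_sqrt_two_pow, one_mul]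

/-- The number of ones of a bit string. -/
def hammingWeight (e : Fin N → Bool) : ℕ := (Finset.univ.filter fun i => e i = true).card

lemma hammingWeight_eq (e : Fin N → Bool) :
    (hammingWeight e : ℝ) = (N - ∑ i, parityChar {i} e) / 2 := by
  have h : ∀ i, parityChar {i} e = 1 - 2 * if e i = true then 1 else 0 := fun i => by
    rw [parityChar, Finset.prod_singleton]
    split_ifs <;> norm_num
  simp only [h]
  rw [Finset.sum_sub_distrib, ← Finset.mul_sum, hammingWeight, Finset.card_filter]
  simp

/-- The expected number of errors of the measurement described by `amplitude p`. -/
lemma sum_sq_amplitude_mul_hammingWeight {p : Finset (Fin N) → ℝ} (hp : ∀ s, 0 ≤ p s)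
    (hp1 : ∑ s, p s = 1) :
    ∑ e, amplitude p e ^ 2 * hammingWeight e =
      N / 2 - ∑ s, ∑ i ∈ sᶜ, √(p s) * √(p (insert i s)) := by
  have h1 : ∑ e, amplitude p e ^ 2 = 1 := by
    have := sum_sq_amplitude_mul_parityChar p ∅
    have h0 : ∀ s : Finset (Fin N), symmDiff s ∅ = s := fun s => symmDiff_bot s
    simpa [parityChar, h0, Real.mul_self_sqrt (hp _), hp1] using this
  have h2 : ∀ i, ∑ s, √(p s) * √(p (symmDiff s {i})) =
      2 * ∑ s : Finset (Fin N), if i ∈ sᶜ then √(p s) * √(p (insert i s)) else 0 := by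
    intro i
    have h3 : ∑ s : Finset (Fin N), (if i ∈ sᶜ then 0 else √(p s) * √(p (symmDiff s {i}))) =
        ∑ s : Finset (Fin N), if i ∈ sᶜ then √(p s) * √(p (symmDiff s {i})) else 0 := by
      rw [← sum_symmDiff {i} fun s : Finset (Fin N) =>
        if i ∈ sᶜ then √(p s) * √(p (symmDiff s {i})) else 0]
      refine Finset.sum_congr rfl fun s _ => ?_
      rw [symmDiff_symmDiff_cancel_right]
      by_cases h : i ∈ s <;> simp [h, mul_comm]
    have h4 : ∀ s : Finset (Fin N), √(p s) * √(p (symmDiff s {i})) =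
        (if i ∈ sᶜ then 0 else √(p s) * √(p (symmDiff s {i}))) +
        if i ∈ sᶜ then √(p s) * √(p (symmDiff s {i})) else 0 := fun s => by split_ifs <;> simp
    rw [Finset.sum_congr rfl fun s _ => h4 s, Finset.sum_add_distrib, h3, ← two_mul]
    congr 1
    refine Finset.sum_congr rfl fun s _ => ?_
    split_ifs with h
    · have : symmDiff s {i} = insert i s := by
        ext j
        rw [Finset.mem_compl] at h
        by_cases hj : j = i
        · subst hj
          simp [Finset.mem_symmDiff, h]
        · simp [Finset.mem_symmDiff, hj]
      rw [this]
    · rfl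
  calc _ = (N * ∑ e, amplitude p e ^ 2 -
        ∑ i, ∑ e, amplitude p e ^ 2 * parityChar {i} e) / 2 := by
        rw [Finset.sum_comm, Finset.mul_sum, ← Finset.sum_sub_distrib, Finset.sum_div]
        refine Finset.sum_congr rfl fun e _ => ?_
        rw [hammingWeight_eq, ← Finset.mul_sum]
        ring
    _ = _ := by
        simp only [h1, sum_sq_amplitude_mul_parityChar, h2]
        rw [← Finset.mul_sum, Finset.sum_comm]
        have h5 : ∀ s : Finset (Fin N),
            ∑ i, (if i ∈ sᶜ then √(p s) * √(p (insert i s)) else 0) =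
            ∑ i ∈ sᶜ, √(p s) * √(p (insert i s)) := fun s => by
          rw [Finset.sum_ite_mem, Finset.univ_inter]
        simp only [h5]
        ring

end Fourier

/-! ### The measurement on a random subset of the bits -/

section SubsetWeight

variable {N : ℕ}

/-- The number of `k`-element sets of positions that contain `s`. -/
def supersetCount (k : ℕ) (s : Finset (Fin N)) : ℕ :=
  ((Finset.univ.powersetCard k).filter (s ⊆ ·)).card

/-- The ratio of `(N - m - 1).choose (k - m - 1)` and `(N - m).choose (k - m)` for `m = |s|`. -/
lemma supersetCount_insert (k : ℕ) {s : Finset (Fin N)} {i : Fin N} (hi : i ∉ s) :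
    supersetCount k (insert i s) * (N - s.card) = supersetCount k s * (k - s.card) := by
  have hN : s.card < N := by
    have := Finset.card_lt_univ_of_notMem hi
    simpa using this
  rcases lt_or_ge s.card k with hk | hk
  · rw [supersetCount, supersetCount,
      Finset.card_filter_powersetCard_subset _ _ _ (Finset.subset_univ _)
        (by rw [Finset.card_insert_of_notMem hi]; exact hk),
      Finset.card_filter_powersetCard_subset _ _ _ (Finset.subset_univ _) hk.le,
      Finset.card_insert_of_notMem hi, Finset.card_univ, Fintype.card_fin]
    obtain ⟨a, ha⟩ := Nat.exists_eq_add_of_lt hN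
    obtain ⟨b, hb⟩ := Nat.exists_eq_add_of_lt hk
    have e1 : N - s.card = a + 1 := by omega
    have e2 : k - s.card = b + 1 := by omega
    have e3 : N - (s.card + 1) = a := by omega
    have e4 : k - (s.card + 1) = b := by omega
    rw [e1, e2, e3, e4, mul_comm, ← Nat.add_one_mul_choose_eq]
  · have : supersetCount k (insert i s) = 0 := by
      rw [supersetCount, Finset.card_eq_zero, Finset.filter_eq_empty_iff]
      intro T hT hsT
      have := Finset.card_le_card hsT
      rw [Finset.card_insert_of_notMem hi, (Finset.mem_powersetCard.1 hT).2] at this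
      omega
    rw [this, Nat.sub_eq_zero_of_le hk, zero_mul, mul_zero]

lemma sum_supersetCount_mul (k : ℕ) (g : Finset (Fin N) → ℝ) :
    ∑ s, supersetCount k s * g s =
      ∑ T ∈ (Finset.univ : Finset (Fin N)).powersetCard k, ∑ s ∈ T.powerset, g s := by
  have h : ∀ T : Finset (Fin N), ∑ s ∈ T.powerset, g s = ∑ s, if s ⊆ T then g s else 0 :=
    fun T => by
      rw [← Finset.sum_filter]
      congr 1
      ext s
      simp
  simp only [h]
  rw [Finset.sum_comm]
  refine Finset.sum_congr rfl fun s _ => ?_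
  rw [← Finset.sum_filter, Finset.sum_const, nsmul_eq_mul, supersetCount]

/-- The distribution of a uniformly random subset of a uniformly random `k`-element set of
positions. -/
noncomputable def subsetWeight (k : ℕ) (s : Finset (Fin N)) : ℝ :=
  supersetCount k s * ((N.choose k : ℝ) * 2 ^ k)⁻¹

lemma subsetWeight_nonneg (k : ℕ) (s : Finset (Fin N)) : 0 ≤ subsetWeight k s := by
  unfold subsetWeight; positivity

/-- The size of the random set is binomially distributed. -/
lemma sum_subsetWeight_mul {k : ℕ} (hk : k ≤ N) (g : ℕ → ℝ) :
    ∑ s : Finset (Fin N), subsetWeight k s * g s.card =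
      (2 ^ k)⁻¹ * ∑ m ∈ Finset.range (k + 1), (k.choose m : ℝ) * g m := by
  have h := sum_supersetCount_mul (N := N) k fun s => g s.card
  have h1 : ∀ T ∈ (Finset.univ : Finset (Fin N)).powersetCard k, ∑ s ∈ T.powerset, g s.card =
      ∑ m ∈ Finset.range (k + 1), (k.choose m : ℝ) * g m := fun T hT => by
    rw [Finset.sum_powerset_apply_card, (Finset.mem_powersetCard.1 hT).2]
    exact Finset.sum_congr rfl fun m _ => by rw [nsmul_eq_mul]
  rw [Finset.sum_congr rfl h1, Finset.sum_const, Finset.card_powersetCard, Finset.card_univ,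
    Fintype.card_fin, nsmul_eq_mul] at h
  have hc : (N.choose k : ℝ) ≠ 0 := by exact_mod_cast (Nat.choose_pos hk).ne'
  calc _ = ((N.choose k : ℝ) * 2 ^ k)⁻¹ *
        ∑ s : Finset (Fin N), (supersetCount k s : ℝ) * g s.card := by
        rw [Finset.mul_sum]
        exact Finset.sum_congr rfl fun s _ => by rw [subsetWeight]; ring
    _ = _ := by
        rw [h]
        field_simp

/-- Adding one position to `s` multiplies the weight by `(k - |s|) / (N - |s|)`, so the sum over the
`N - |s|` possible positions collapses to one square root. Both sides vanish for `|s| ≥ k`, where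
the subtraction is truncated. -/
lemma sum_sqrt_subsetWeight_insert (k : ℕ) (s : Finset (Fin N)) :
    ∑ i ∈ sᶜ, √(subsetWeight k s) * √(subsetWeight k (insert i s)) =
      subsetWeight k s * √(((k - s.card : ℕ) : ℝ) * ((N - s.card : ℕ) : ℝ)) := by
  rcases Finset.eq_empty_or_nonempty sᶜ with h | h
  · have : N - s.card = 0 := by
      rw [← Finset.card_eq_zero, Finset.card_compl, Fintype.card_fin] at h
      exact h
    rw [h, this]
    simp
  have h1 : ∀ i ∈ sᶜ, √(subsetWeight k s) * √(subsetWeight k (insert i s)) =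
      subsetWeight k s * √(((k - s.card : ℕ) : ℝ) * ((N - s.card : ℕ) : ℝ)) *
        ((N - s.card : ℕ) : ℝ)⁻¹ := by
    intro i hi
    have hN : 0 < N - s.card := by
      have := Finset.card_pos.2 h
      rwa [Finset.card_compl, Fintype.card_fin] at this
    have hN' : (0 : ℝ) < ((N - s.card : ℕ) : ℝ) := by exact_mod_cast hN
    have h2 : subsetWeight k (insert i s) =
        subsetWeight k s * (((k - s.card : ℕ) : ℝ) * ((N - s.card : ℕ) : ℝ)) *
          (((N - s.card : ℕ) : ℝ) ^ 2)⁻¹ := by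
      have h3 : (supersetCount k (insert i s) : ℝ) * ((N - s.card : ℕ) : ℝ) =
          supersetCount k s * ((k - s.card : ℕ) : ℝ) := by
        exact_mod_cast supersetCount_insert k (Finset.mem_compl.1 hi)
      have h4 : (supersetCount k (insert i s) : ℝ) =
          supersetCount k s * ((k - s.card : ℕ) : ℝ) * ((N - s.card : ℕ) : ℝ)⁻¹ :=
        (eq_mul_inv_iff_mul_eq₀ hN'.ne').2 h3
      rw [subsetWeight, subsetWeight, h4]
      field_simp
    rw [h2, Real.sqrt_mul (mul_nonneg (subsetWeight_nonneg _ _) (by positivity)),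
      Real.sqrt_mul (subsetWeight_nonneg _ _), Real.sqrt_inv, Real.sqrt_sq hN'.le,
      ← mul_assoc, ← mul_assoc, Real.mul_self_sqrt (subsetWeight_nonneg _ _)]
  rw [Finset.sum_congr rfl h1, Finset.sum_const, nsmul_eq_mul, Finset.card_compl,
    Fintype.card_fin]
  have hN : ((N - s.card : ℕ) : ℝ) ≠ 0 := by
    have := Finset.card_pos.2 h
    rw [Finset.card_compl, Fintype.card_fin] at this
    exact_mod_cast this.ne'
  field_simp

lemma sum_choose_mul_sub (k : ℕ) :
    ∑ m ∈ Finset.range (k + 1), (k.choose m : ℝ) * ((k : ℝ) - m) = 2 ^ k * (k / 2) := by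
  have h1 : ∑ m ∈ Finset.range (k + 1), (k.choose m : ℝ) * m =
      ∑ m ∈ Finset.range (k + 1), (k.choose m : ℝ) * ((k : ℝ) - m) := by
    rw [← Finset.sum_range_reflect]
    refine Finset.sum_congr rfl fun m hm => ?_
    have hm' : m ≤ k := by rw [Finset.mem_range] at hm; omega
    rw [show k + 1 - 1 - m = k - m by omega, Nat.choose_symm hm', Nat.cast_sub hm']
  have h2 : ∑ m ∈ Finset.range (k + 1), (k.choose m : ℝ) = 2 ^ k := by
    exact_mod_cast Nat.sum_range_choose k
  have h3 : ∑ m ∈ Finset.range (k + 1), (k.choose m : ℝ) * m +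
      ∑ m ∈ Finset.range (k + 1), (k.choose m : ℝ) * ((k : ℝ) - m) = 2 ^ k * k := by
    rw [← Finset.sum_add_distrib, ← h2, Finset.sum_mul]
    exact Finset.sum_congr rfl fun m _ => by ring
  linarith

lemma sum_choose_div_le (k : ℕ) :
    ∑ m ∈ Finset.range (k + 1), (k.choose m : ℝ) * ((k : ℝ) - m + 1)⁻¹ ≤
      2 ^ k * (2 / (k + 1)) := by
  have h1 : ∀ m ∈ Finset.range (k + 1), (k.choose m : ℝ) * ((k : ℝ) - m + 1)⁻¹ =
      ((k + 1).choose m : ℝ) * ((k : ℝ) + 1)⁻¹ := by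
    intro m hm
    have hm' : m ≤ k := by rw [Finset.mem_range] at hm; omega
    have h := Nat.choose_mul_succ_eq k m
    have h' : (k.choose m : ℝ) * (k + 1) = (k + 1).choose m * ((k : ℝ) - m + 1) := by
      have h2 : ((k + 1 - m : ℕ) : ℝ) = (k : ℝ) - m + 1 := by
        rw [Nat.cast_sub (by omega)]; push_cast; ring
      rw [← h2]
      exact_mod_cast h
    have hpos : (0 : ℝ) < (k : ℝ) - m + 1 := by
      have : (m : ℝ) ≤ k := by exact_mod_cast hm'
      linarith
    field_simp
    linarith
  rw [Finset.sum_congr rfl h1, ← Finset.sum_mul]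
  have h2 : ∑ m ∈ Finset.range (k + 1), ((k + 1).choose m : ℝ) ≤ 2 ^ (k + 1) := by
    have := Nat.sum_range_choose (k + 1)
    rw [Finset.sum_range_succ] at this
    exact_mod_cast (Nat.le_add_right _ _).trans this.le
  refine (mul_le_mul_of_nonneg_right h2 (by positivity)).trans_eq ?_
  rw [pow_succ]
  field_simp

/-- The square root is close to its arithmetic-geometric upper bound `a + r / 2`; the assumption
`1 ≤ r` keeps the estimate valid at `a = 0`. -/
lemma le_sqrt_mul_add {a r : ℝ} (ha : 0 ≤ a) (hr : 1 ≤ r) :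
    a + r / 2 - r ^ 2 / 2 * (a + 1)⁻¹ ≤ √(a * (a + r)) := by
  set s := √(a * (a + r)) with hs
  have hs0 : 0 ≤ s := Real.sqrt_nonneg _
  have hs2 : s * s = a * (a + r) := Real.mul_self_sqrt (by positivity)
  have hle : s ≤ a + r / 2 :=
    Real.sqrt_le_iff.2 ⟨by positivity, by nlinarith [sq_nonneg r]⟩
  have h1 : (a + r / 2 - s) * (a + 1) ≤ r ^ 2 / 2 := by nlinarith
  have h2 : a + r / 2 - s ≤ r ^ 2 / 2 * (a + 1)⁻¹ := by
    rw [← div_eq_mul_inv, le_div_iff₀ (by positivity)]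
    exact h1
  linarith

/-- Given the bits of `x` at a uniformly random `k`-element set of positions, in superposition, a
measurement with these error amplitudes guesses all of `x` with at most `(N - k) ^ 2 / (k + 1)`
errors in expectation. -/
lemma exists_amplitude {k : ℕ} (hk : k < N) : ∃ a : (Fin N → Bool) → ℝ,
    (∀ d : Fin N → Bool, ∑ e, a e * a (fun i => xor (e i) (d i)) =
      (N.choose k : ℝ)⁻¹ * ∑ T ∈ Finset.univ.powersetCard k,
        if ∀ i ∈ T, d i = false then 1 else 0) ∧
    ∑ e, a e ^ 2 * hammingWeight e ≤ ((N : ℝ) - k) ^ 2 / (k + 1) := by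
  refine ⟨amplitude (subsetWeight k), fun d => ?_, ?_⟩
  · rw [sum_amplitude_mul_amplitude_xor (subsetWeight_nonneg k)]
    have h := sum_supersetCount_mul k fun s => parityChar s d
    calc _ = ((N.choose k : ℝ) * 2 ^ k)⁻¹ * ∑ s, supersetCount k s * parityChar s d := by
          rw [Finset.mul_sum]
          exact Finset.sum_congr rfl fun s _ => by rw [subsetWeight]; ring
      _ = _ := by
          rw [h, mul_inv, mul_assoc, Finset.mul_sum]
          congr 1
          refine Finset.sum_congr rfl fun T hT => ?_
          rw [sum_powerset_parityChar, (Finset.mem_powersetCard.1 hT).2]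
          split_ifs <;> simp
  · have hp1 : ∑ s : Finset (Fin N), subsetWeight k s = 1 := by
      have h := sum_subsetWeight_mul hk.le fun _ => 1
      have h2 : ∑ m ∈ Finset.range (k + 1), (k.choose m : ℝ) = 2 ^ k := by
        exact_mod_cast Nat.sum_range_choose k
      simpa [h2] using h
    rw [sum_sq_amplitude_mul_hammingWeight (subsetWeight_nonneg k) hp1]
    simp only [sum_sqrt_subsetWeight_insert]
    rw [sum_subsetWeight_mul hk.le fun m => √(((k - m : ℕ) : ℝ) * ((N - m : ℕ) : ℝ))]
    have hr : (1 : ℝ) ≤ N - k := by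
      have : (k : ℝ) + 1 ≤ N := by exact_mod_cast hk
      linarith
    set r : ℝ := N - k with hr'
    have h1 : ∑ m ∈ Finset.range (k + 1), (k.choose m : ℝ) *
          (((k : ℝ) - m) + r / 2 - r ^ 2 / 2 * ((k : ℝ) - m + 1)⁻¹) ≤
        ∑ m ∈ Finset.range (k + 1), (k.choose m : ℝ) *
          √(((k - m : ℕ) : ℝ) * ((N - m : ℕ) : ℝ)) := by
      refine Finset.sum_le_sum fun m hm => mul_le_mul_of_nonneg_left ?_ (by positivity)
      have hm' : m ≤ k := by rw [Finset.mem_range] at hm; omega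
      rw [Nat.cast_sub hm', Nat.cast_sub (hm'.trans hk.le)]
      have : (m : ℝ) ≤ k := by exact_mod_cast hm'
      refine (le_sqrt_mul_add (sub_nonneg.2 this) hr).trans_eq ?_
      congr 2
      rw [hr']; ring
    have h2 : ∑ m ∈ Finset.range (k + 1), (k.choose m : ℝ) *
          (((k : ℝ) - m) + r / 2 - r ^ 2 / 2 * ((k : ℝ) - m + 1)⁻¹) =
        2 ^ k * (k / 2) + 2 ^ k * (r / 2) - r ^ 2 / 2 *
          ∑ m ∈ Finset.range (k + 1), (k.choose m : ℝ) * ((k : ℝ) - m + 1)⁻¹ := by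
      have h3 : ∑ m ∈ Finset.range (k + 1), (k.choose m : ℝ) = 2 ^ k := by
        exact_mod_cast Nat.sum_range_choose k
      rw [← sum_choose_mul_sub, ← h3, Finset.sum_mul, Finset.mul_sum, ← Finset.sum_add_distrib,
        ← Finset.sum_sub_distrib]
      exact Finset.sum_congr rfl fun m _ => by ring
    have h4 := mul_le_mul_of_nonneg_left (sum_choose_div_le k) (by positivity : 0 ≤ r ^ 2 / 2)
    have h5 : (2 ^ k : ℝ) * (k / 2) + 2 ^ k * (r / 2) - r ^ 2 / 2 * (2 ^ k * (2 / (k + 1))) ≤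
        ∑ m ∈ Finset.range (k + 1), (k.choose m : ℝ) *
          √(((k - m : ℕ) : ℝ) * ((N - m : ℕ) : ℝ)) := by linarith
    have h6 := mul_le_mul_of_nonneg_left h5 (by positivity : (0 : ℝ) ≤ (2 ^ k)⁻¹)
    have h7 : (2 ^ k : ℝ)⁻¹ * (2 ^ k * (k / 2) + 2 ^ k * (r / 2) -
        r ^ 2 / 2 * (2 ^ k * (2 / (k + 1)))) = k / 2 + r / 2 - r ^ 2 / (k + 1) := by
      field_simp
    have h8 : (N : ℝ) / 2 = k / 2 + r / 2 := by rw [hr']; ring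
    linarith

end SubsetWeight

/-! ### Locating errors by binary search -/

section AdaptiveSearch

variable {N : ℕ}

/-- `Searchable E D` says that a string known to lie in `E` can be identified by adaptive tests
of the form "is `e` zero on `A`?", with at most `D e` tests if the string is `e`. -/
inductive Searchable : Finset (Fin N → Bool) → ((Fin N → Bool) → ℕ) → Prop
  | leaf {E D} (e : Fin N → Bool) (h : ∀ e' ∈ E, e' = e) : Searchable E D
  | node {E D} (A : Finset (Fin N)) (h1 : Searchable (E.filter fun e => ∀ i ∈ A, e i = false) D)
      (h0 : Searchable (E.filter fun e => ¬ ∀ i ∈ A, e i = false) D) :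
      Searchable E fun e => D e + 1
  | mono {E D D'} (h : Searchable E D) (hD : ∀ e ∈ E, D e ≤ D' e) : Searchable E D'

/-- Binary search in `A`. The search goes on at cost `K` once the string is known on `A`. A test
that finds no one costs `1`; a test that finds a one is paid for by that one, at its depth. -/
lemma Searchable.binarySearch (d : ℕ) (A : Finset (Fin N)) (hA : A.card ≤ 2 ^ d)
    (E : Finset (Fin N → Bool)) (K : (Fin N → Bool) → ℕ)
    (h : ∀ E' ⊆ E, (∀ e ∈ E', ∀ e' ∈ E', ∀ i ∈ A, e i = e' i) → Searchable E' K) :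
    Searchable E fun e => K e + (1 + 2 * d * (A.filter fun i => e i = true).card) := by
  have hzero : Searchable (E.filter fun e => ∀ i ∈ A, e i = false) K := by
    refine h _ (Finset.filter_subset _ _) fun e he e' he' i hi => ?_
    rw [(Finset.mem_filter.1 he).2 i hi, (Finset.mem_filter.1 he').2 i hi]
  induction d generalizing A E K with
  | zero =>
    refine (Searchable.node A hzero (h _ (Finset.filter_subset _ _) ?_)).mono
      fun e _ => by omega
    have key : ∀ e : Fin N → Bool, (¬ ∀ i ∈ A, e i = false) → ∀ i ∈ A, e i = true := by
      intro e he i hi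
      push Not at he
      obtain ⟨j, hj, hej⟩ := he
      rw [Finset.card_le_one.1 (by simpa using hA) i hi j hj]
      simpa using hej
    intro e he e' he' i hi
    rw [key e (Finset.mem_filter.1 he).2 i hi, key e' (Finset.mem_filter.1 he').2 i hi]
  | succ d ih =>
    obtain ⟨A₁, hA₁, hc⟩ := Finset.exists_subset_card_eq (min_le_left A.card (2 ^ d))
    have hc₂ : (A \ A₁).card ≤ 2 ^ d := by
      rw [Finset.card_sdiff_of_subset hA₁, hc]
      rw [pow_succ] at hA
      omega
    have hw : ∀ e : Fin N → Bool, (A.filter fun i => e i = true).card =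
        (A₁.filter fun i => e i = true).card + ((A \ A₁).filter fun i => e i = true).card := by
      intro e
      rw [← Finset.card_union_of_disjoint (Finset.disjoint_filter_filter Finset.disjoint_sdiff),
        ← Finset.filter_union, Finset.union_sdiff_of_subset hA₁]
    have hnonzero : Searchable (E.filter fun e => ¬ ∀ i ∈ A, e i = false) fun e =>
        K e + (1 + 2 * d * ((A \ A₁).filter fun i => e i = true).card) +
          (1 + 2 * d * (A₁.filter fun i => e i = true).card) := by
      have h2 : ∀ E' ⊆ E, (∀ e ∈ E', ∀ e' ∈ E', ∀ i ∈ A₁, e i = e' i) → Searchable E' fun e =>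
          K e + (1 + 2 * d * ((A \ A₁).filter fun i => e i = true).card) := by
        intro E' hE' hag
        have h3 : ∀ E'' ⊆ E', (∀ e ∈ E'', ∀ e' ∈ E'', ∀ i ∈ A \ A₁, e i = e' i) →
            Searchable E'' K := by
          refine fun E'' hE'' hag' => h E'' (hE''.trans hE') fun e he e' he' i hi => ?_
          by_cases hi₁ : i ∈ A₁
          · exact hag e (hE'' he) e' (hE'' he') i hi₁
          · exact hag' e he e' he' i (Finset.mem_sdiff.2 ⟨hi, hi₁⟩)
        refine ih _ hc₂ E' K h3 (h3 _ (Finset.filter_subset _ _) fun e he e' he' i hi => ?_)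
        rw [(Finset.mem_filter.1 he).2 i hi, (Finset.mem_filter.1 he').2 i hi]
      have h4 : ∀ E' ⊆ E.filter (fun e => ¬ ∀ i ∈ A, e i = false),
          (∀ e ∈ E', ∀ e' ∈ E', ∀ i ∈ A₁, e i = e' i) → Searchable E' fun e =>
          K e + (1 + 2 * d * ((A \ A₁).filter fun i => e i = true).card) :=
        fun E' hE' => h2 E' (hE'.trans (Finset.filter_subset _ _))
      refine ih A₁ (hc.trans_le (min_le_right _ _)) _ _ h4
        (h4 _ (Finset.filter_subset _ _) fun e he e' he' i hi => ?_)
      rw [(Finset.mem_filter.1 he).2 i hi, (Finset.mem_filter.1 he').2 i hi]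
    refine (Searchable.node (D := fun e => K e + if ∀ i ∈ A, e i = false then 0 else
      2 + 2 * d * (A.filter fun i => e i = true).card) A
      (hzero.mono fun e _ => Nat.le_add_right _ _) (hnonzero.mono fun e he => ?_)).mono
      fun e _ => ?_
    · rw [if_neg (Finset.mem_filter.1 he).2, hw]
      apply le_of_eq
      ring
    · split_ifs with hz
      · omega
      · have h1 : 1 ≤ (A.filter fun i => e i = true).card := by
          push Not at hz
          obtain ⟨i, hi, hei⟩ := hz
          exact Finset.card_pos.2 ⟨i, Finset.mem_filter.2 ⟨hi, by simpa using hei⟩⟩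
        nlinarith

lemma searchable_univ {d : ℕ} (hN : N ≤ 2 ^ d) :
    Searchable (Finset.univ : Finset (Fin N → Bool)) fun e => 1 + 2 * d * hammingWeight e := by
  have h := Searchable.binarySearch (N := N) d Finset.univ (by simpa using hN) Finset.univ
    (fun _ => 0) fun E' _ hE' => by
      rcases E'.eq_empty_or_nonempty with rfl | ⟨e, he⟩
      · exact .leaf default (by simp)
      · exact .leaf e fun e' he' => funext fun i => hE' e' he' e he i (Finset.mem_univ i)
  simpa [hammingWeight] using h

end AdaptiveSearch

/-! ### The rounds of the algorithm -/

section Rounds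

variable {n N : ℕ}

/-- The Gram matrix, up to the factor `n!`, of the superposition over all orders `π` of the
positions of the first `k` bits of `x` in that order. -/
def prefixGram (n k : ℕ) (x y : Fin n → Bool) : ℝ :=
  ∑ π : Equiv.Perm (Fin n), if ∀ i : Fin n, (i : ℕ) < k → x (π i) = y (π i) then 1 else 0

lemma prefixGram_zero (x y : Fin n → Bool) : prefixGram n 0 x y = n.factorial := by
  simp [prefixGram, Fintype.card_perm]

lemma prefixGram_self_of_ne {x y : Fin n → Bool} (h : x ≠ y) : prefixGram n n x y = 0 := by
  refine Finset.sum_eq_zero fun π _ => if_neg fun hπ => h (funext fun i => ?_)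
  simpa using hπ (π.symm i) (Fin.is_lt _)

/-- In a random order the first `k` positions are a uniformly random set, so they may be replaced by
the images of any fixed `k`-element set `B`. -/
lemma sum_perm_agree_eq_prefixGram {k : ℕ} (hk : k ≤ n) {B : Finset (Fin n)} (hB : B.card = k)
    (x y : Fin n → Bool) :
    ∑ π : Equiv.Perm (Fin n), (if ∀ i ∈ B, x (π i) = y (π i) then (1 : ℝ) else 0) =
      prefixGram n k x y := by
  have hcard : Fintype.card {i : Fin n // (i : ℕ) < k} = Fintype.card {i // i ∈ B} := by
    rw [Fintype.card_coe, hB, Fintype.card_subtype]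
    exact (Fin.card_filter_val_lt).trans (min_eq_right hk)
  set σ : Equiv.Perm (Fin n) := (Fintype.equivOfCardEq hcard).extendSubtype
  refine Fintype.sum_equiv (Equiv.mulRight σ) _ _ fun π => ?_
  refine if_congr ⟨fun h i hi => ?_, fun h j hj => ?_⟩ rfl rfl
  · exact h (σ i) (Equiv.extendSubtype_mem _ i hi)
  · have hj' : ((σ.symm j : Fin n) : ℕ) < k := by
      by_contra hlt
      have := Equiv.extendSubtype_not_mem (Fintype.equivOfCardEq hcard) (σ.symm j) hlt
      rw [show (Fintype.equivOfCardEq hcard).extendSubtype = σ from rfl,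
        Equiv.apply_symm_apply] at this
      exact this hj
    simpa using h (σ.symm j) hj'

/-- The errors of the guess `z` for the first `N` bits of `x` in the order `π`. -/
def guessError (hN : N ≤ n) (x : Fin n → Bool) (j : Equiv.Perm (Fin n) × (Fin N → Bool)) :
    Fin N → Bool := fun i => xor (j.2 i) (x (j.1 (Fin.castLE hN i)))

/-- The Gram matrix, up to the factor `n!`, of the superposition over all orders of the guesses
for the first `N` bits, with error amplitudes `a`, restricted to errors in `E`. -/
noncomputable def guessGram (hN : N ≤ n) (a : (Fin N → Bool) → ℝ) (E : Finset (Fin N → Bool))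
    (x y : Fin n → Bool) : ℝ :=
  ∑ j : Equiv.Perm (Fin n) × (Fin N → Bool),
    (if guessError hN x j ∈ E then a (guessError hN x j) else 0) *
      if guessError hN y j ∈ E then a (guessError hN y j) else 0

lemma sum_xor (v : Fin N → Bool) (g : (Fin N → Bool) → ℝ) :
    ∑ z : Fin N → Bool, g (fun i => xor (z i) (v i)) = ∑ z, g z :=
  Fintype.sum_equiv ⟨fun z i => xor (z i) (v i), fun z i => xor (z i) (v i),
    fun z => by simp, fun z => by simp⟩ _ _ fun _ => rfl

lemma guessGram_eq (hN : N ≤ n) (a : (Fin N → Bool) → ℝ) (E : Finset (Fin N → Bool))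
    (x y : Fin n → Bool) :
    guessGram hN a E x y = ∑ π : Equiv.Perm (Fin n), ∑ e, (if e ∈ E then a e else 0) *
      (fun e' => if e' ∈ E then a e' else 0) (fun i => xor (e i)
        (xor (x (π (Fin.castLE hN i))) (y (π (Fin.castLE hN i))))) := by
  rw [guessGram, Fintype.sum_prod_type]
  refine Finset.sum_congr rfl fun π _ => ?_
  rw [← sum_xor fun i => x (π (Fin.castLE hN i))]
  refine Finset.sum_congr rfl fun z _ => ?_
  have hx : guessError hN x (π, fun i => xor (z i) (x (π (Fin.castLE hN i)))) = z := by
    funext i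
    simp [guessError]
  have hy : guessError hN y (π, fun i => xor (z i) (x (π (Fin.castLE hN i)))) =
      fun i => xor (z i) (xor (x (π (Fin.castLE hN i))) (y (π (Fin.castLE hN i)))) := by
    funext i
    simp [guessError]
  rw [hx, hy]

lemma guessGram_self (hN : N ≤ n) (a : (Fin N → Bool) → ℝ) (E : Finset (Fin N → Bool))
    (x : Fin n → Bool) : guessGram hN a E x x = n.factorial * ∑ e ∈ E, a e ^ 2 := by
  rw [guessGram_eq]
  simp only [Bool.xor_self, Bool.xor_false]
  rw [Finset.sum_const, Finset.card_univ, Fintype.card_perm, Fintype.card_fin, nsmul_eq_mul]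
  congr 1
  have h : ∑ e ∈ E, a e ^ 2 = ∑ e, if e ∈ E then a e ^ 2 else 0 := by
    rw [Finset.sum_ite_mem, Finset.univ_inter]
  rw [h]
  exact Finset.sum_congr rfl fun e _ => by split_ifs <;> simp [sq]

lemma guessGram_singleton (hN : N ≤ n) (a : (Fin N → Bool) → ℝ) (e : Fin N → Bool)
    (x y : Fin n → Bool) : guessGram hN a {e} x y = a e ^ 2 * prefixGram n N x y := by
  rw [guessGram_eq, prefixGram, Finset.mul_sum]
  refine Finset.sum_congr rfl fun π _ => ?_
  rw [Finset.sum_eq_single e]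
  · have h : ((fun i => xor (e i) (xor (x (π (Fin.castLE hN i))) (y (π (Fin.castLE hN i))))) ∈
        ({e} : Finset (Fin N → Bool))) ↔ ∀ i : Fin n, (i : ℕ) < N → x (π i) = y (π i) := by
      rw [Finset.mem_singleton]
      constructor
      · intro h i hi
        have h1 : xor (e ⟨i, hi⟩) (xor (x (π i)) (y (π i))) = e ⟨i, hi⟩ := congrFun h ⟨i, hi⟩
        revert h1
        cases e ⟨i, hi⟩ <;> cases x (π i) <;> cases y (π i) <;> simp
      · intro h
        funext i
        simp [h (Fin.castLE hN i) i.2]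
    beta_reduce
    by_cases h2 : ∀ i : Fin n, (i : ℕ) < N → x (π i) = y (π i)
    · rw [if_pos h2, if_pos (h.2 h2), if_pos (Finset.mem_singleton_self e),
        Finset.mem_singleton.1 (h.2 h2)]
      ring
    · rw [if_neg h2, if_neg (mt h.1 h2), mul_zero, mul_zero]
  · intro e' _ he'
    simp [he']
  · simp

/-- The query that tests whether the guess `z` in the order `π` has no error in `A`. -/
def errorQuery (hN : N ≤ n) (A : Finset (Fin N)) (j : Equiv.Perm (Fin n) × (Fin N → Bool)) :
    Query n :=
  ⟨A.image fun i => j.1 (Fin.castLE hN i),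
    fun i => if h : ((j.1.symm i : Fin n) : ℕ) < N then j.2 ⟨j.1.symm i, h⟩ else false⟩

lemma reply_errorQuery (hN : N ≤ n) (A : Finset (Fin N)) (x : Fin n → Bool)
    (j : Equiv.Perm (Fin n) × (Fin N → Bool)) :
    reply x (errorQuery hN A j) = true ↔ ∀ i ∈ A, guessError hN x j i = false := by
  rw [reply, decide_eq_true_iff]
  constructor
  · intro h i hi
    have h1 := h ⟨j.1 (Fin.castLE hN i), Finset.mem_image_of_mem _ hi⟩
    simp only [errorQuery, Equiv.symm_apply_apply, Fin.val_castLE, Fin.is_lt, dif_pos,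
      Fin.eta] at h1
    rw [guessError, h1, Bool.xor_self]
  · rintro h ⟨i, hi⟩
    obtain ⟨i, hi', rfl⟩ := Finset.mem_image.1 hi
    have h1 := h i hi'
    simp only [guessError, bne_eq_false_iff_eq] at h1
    simp [errorQuery, h1]

/-- Learning the errors of a guess. -/
lemma Solves.of_searchable (hN : N ≤ n) (a : (Fin N → Bool) → ℝ) {c : ℝ} (hc : 0 ≤ c)
    (hs : Solves (prefixGram n N) (n.factorial * c)) {E : Finset (Fin N → Bool)}
    {D : (Fin N → Bool) → ℕ} (hE : Searchable E D) :
    Solves (guessGram hN a E) (n.factorial * ∑ e ∈ E, a e ^ 2 * (D e + c)) := by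
  induction hE with
  | @leaf E D e h =>
    have hG : guessGram hN a E = fun x y => (∑ e' ∈ E, a e' ^ 2) * prefixGram n N x y := by
      rcases Finset.subset_singleton_iff.1 (fun e' he' => Finset.mem_singleton.2 (h e' he'))
        with rfl | rfl
      · funext x y
        simp [guessGram]
      · funext x y
        rw [guessGram_singleton, Finset.sum_singleton]
    -- The known errors are corrected without a query: only a factor of the Gram matrix is left.
    rw [hG]
    refine (hs.smul (Finset.sum_nonneg fun _ _ => sq_nonneg _)).mono ?_
    rw [mul_left_comm, Finset.sum_mul]
    gcongr with e' he'
    exact le_add_of_nonneg_left (by positivity)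
  | @mono E D D' _ hD ih =>
    refine ih.mono ?_
    gcongr with e he
    exact hD e he
  | @node E D A _ _ ih1 ih0 =>
    have hinj : Function.Injective fun j : Equiv.Perm (Fin n) × (Fin N → Bool) =>
        ((j.1, fun i => if h : (i : ℕ) < N then j.2 ⟨i, h⟩ else false) : WorkIndex n) := by
      rintro ⟨π, z⟩ ⟨π', z'⟩ h
      rw [Prod.mk.injEq] at h
      refine Prod.ext h.1 (funext fun i => ?_)
      have := congrFun h.2 (Fin.castLE hN i)
      simpa using this
    refine (Solves.query hinj (errorQuery hN A)
      (fun x j => if guessError hN x j ∈ E then a (guessError hN x j) else 0)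
      (G := guessGram hN a E)
      (G' := fun b => guessGram hN a (E.filter fun e => (∀ i ∈ A, e i = false) ↔ b = true))
      (c := fun b => n.factorial * ∑ e ∈ E.filter (fun e => (∀ i ∈ A, e i = false) ↔ b = true),
        a e ^ 2 * (D e + c))
      (fun x y => rfl) (fun b x y => ?_) (fun x => (guessGram_self hN a E x).le)
      (fun b => mul_nonneg (by positivity) (Finset.sum_nonneg fun e _ =>
        mul_nonneg (sq_nonneg _) (by positivity))) fun b => ?_).mono (le_of_eq ?_)
    · rw [guessGram]
      refine Finset.sum_congr rfl fun j _ => ?_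
      have hr : ∀ x, reply x (errorQuery hN A j) = b ↔
          ((∀ i ∈ A, guessError hN x j i = false) ↔ b = true) := fun x => by
        rw [← reply_errorQuery]
        cases b <;> cases reply x (errorQuery hN A j) <;> simp
      simp only [Finset.mem_filter, ← hr]
      by_cases h1 : reply x (errorQuery hN A j) = b <;>
        by_cases h2 : reply y (errorQuery hN A j) = b <;> simp [h1, h2]
    · cases b
      · simpa using ih0
      · simpa using ih1
    · rw [← mul_add, ← mul_add]
      simp only [iff_true, Bool.false_eq_true, iff_false]
      rw [Finset.sum_filter_add_sum_filter_not, ← Finset.sum_add_distrib]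
      exact congrArg _ (Finset.sum_congr rfl fun e _ => by push_cast; ring)

/-- One round of the algorithm, from `k` known bits to `N`. -/
lemma Solves.round {k d : ℕ} (hk : k < N) (hN : N ≤ n) (hd : n ≤ 2 ^ d) {c : ℝ} (hc : 0 ≤ c)
    (h : Solves (prefixGram n N) (n.factorial * c)) :
    Solves (prefixGram n k)
      (n.factorial * (c + (1 + 2 * d * (((N : ℝ) - k) ^ 2 / (k + 1))))) := by
  obtain ⟨a, ha, haw⟩ := exists_amplitude hk
  have hC : (N.choose k : ℝ) ≠ 0 := by exact_mod_cast (Nat.choose_pos hk.le).ne'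
  have h1 : ∑ e, a e ^ 2 = 1 := by
    have h0 := ha fun _ => false
    simp only [Bool.xor_false, implies_true, if_true, Finset.sum_const, nsmul_eq_mul, mul_one,
      Finset.card_powersetCard, Finset.card_univ, Fintype.card_fin] at h0
    rw [inv_mul_cancel₀ hC] at h0
    simpa [sq] using h0
  have hG : prefixGram n k = guessGram hN a Finset.univ := by
    funext x y
    rw [guessGram_eq]
    simp only [Finset.mem_univ, if_true, ha]
    rw [← Finset.mul_sum, Finset.sum_comm]
    have hT : ∀ T ∈ (Finset.univ : Finset (Fin N)).powersetCard k,
        ∑ π : Equiv.Perm (Fin n), (if ∀ i ∈ T,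
          xor (x (π (Fin.castLE hN i))) (y (π (Fin.castLE hN i))) = false then (1 : ℝ) else 0) =
        prefixGram n k x y := by
      intro T hT
      rw [← sum_perm_agree_eq_prefixGram (hk.le.trans hN) (B := T.map (Fin.castLEEmb hN))
        (by rw [Finset.card_map, (Finset.mem_powersetCard.1 hT).2])]
      refine Finset.sum_congr rfl fun π _ => ?_
      simp
    rw [Finset.sum_congr rfl hT, Finset.sum_const, nsmul_eq_mul, Finset.card_powersetCard,
      Finset.card_univ, Fintype.card_fin, ← mul_assoc, inv_mul_cancel₀ hC, one_mul]
  rw [hG]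
  refine (Solves.of_searchable hN a hc h (searchable_univ (hN.trans hd))).mono ?_
  have h2 : ∑ e, a e ^ 2 * (((1 + 2 * d * hammingWeight e : ℕ) : ℝ) + c) =
      c + (1 + 2 * d * ∑ e, a e ^ 2 * hammingWeight e) := by
    calc _ = (1 + c) * ∑ e, a e ^ 2 + 2 * d * ∑ e, a e ^ 2 * hammingWeight e := by
          rw [Finset.mul_sum, Finset.mul_sum, ← Finset.sum_add_distrib]
          exact Finset.sum_congr rfl fun e _ => by push_cast; ring
      _ = _ := by rw [h1]; ring
  rw [h2]
  gcongr

/-- With `m` rounds to go, the numbers of known bits are consecutive squares. -/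
lemma solves_prefixGram_sq {d : ℕ} (hd : n ≤ 2 ^ d) (m j : ℕ) (h : n ≤ (m + j) ^ 2) :
    Solves (prefixGram n (min (j ^ 2) n)) (n.factorial * (m * (1 + 10 * d))) := by
  induction m generalizing j with
  | zero =>
    rw [min_eq_right (by simpa using h)]
    refine (solves_of_diagonal (fun x y hxy => prefixGram_self_of_ne hxy) fun x => ?_).mono
      (by simp)
    exact Finset.sum_nonneg fun π _ => by split_ifs <;> norm_num
  | succ m ih =>
    have h1 := ih (j + 1) (by rw [← add_assoc, add_right_comm]; exact h)
    rcases le_or_gt n (j ^ 2) with hj | hj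
    · rw [min_eq_right (hj.trans (Nat.pow_le_pow_left (Nat.le_succ j) 2))] at h1
      rw [min_eq_right hj]
      refine h1.mono ?_
      gcongr
      simp
    · rw [min_eq_left hj.le]
      have hlt : j ^ 2 < min ((j + 1) ^ 2) n :=
        lt_min (Nat.pow_lt_pow_left (Nat.lt_succ_self j) two_ne_zero) hj
      refine (Solves.round hlt (min_le_right _ _) hd (by positivity) h1).mono ?_
      have hr0 : (0 : ℝ) ≤ ((min ((j + 1) ^ 2) n : ℕ) : ℝ) - ((j ^ 2 : ℕ) : ℝ) :=
        sub_nonneg.2 (by exact_mod_cast hlt.le)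
      have hr : ((min ((j + 1) ^ 2) n : ℕ) : ℝ) - ((j ^ 2 : ℕ) : ℝ) ≤ 2 * j + 1 := by
        have : ((min ((j + 1) ^ 2) n : ℕ) : ℝ) ≤ (((j + 1) ^ 2 : ℕ) : ℝ) := by
          exact_mod_cast min_le_left _ _
        push_cast at this ⊢
        linarith
      have hq : (((min ((j + 1) ^ 2) n : ℕ) : ℝ) - ((j ^ 2 : ℕ) : ℝ)) ^ 2 /
          (((j ^ 2 : ℕ) : ℝ) + 1) ≤ 5 := by
        -- `(2 * j + 1) ^ 2 ≤ 5 * (j ^ 2 + 1)`, because `(j - 2) ^ 2 ≥ 0`.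
        rw [div_le_iff₀ (by positivity)]
        refine (pow_le_pow_left₀ hr0 hr 2).trans ?_
        push_cast
        nlinarith [sq_nonneg ((j : ℝ) - 2)]
      have hq' := mul_le_mul_of_nonneg_left hq (by positivity : (0 : ℝ) ≤ 2 * d)
      refine mul_le_mul_of_nonneg_left ?_ (by positivity)
      push_cast at hq' ⊢
      linarith

lemma sqrt_mul_clog_le (hn : 2 ≤ n) :
    ((n.sqrt + 1 : ℕ) : ℝ) * (1 + 10 * (Nat.clog 2 n : ℝ)) ≤ 64 * (√n * Real.log n) := by
  have hn1 : (2 : ℝ) ≤ n := by exact_mod_cast hn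
  have hlog2 : (0.6931 : ℝ) < Real.log 2 := by linarith [Real.log_two_gt_d9]
  have hlog : Real.log 2 ≤ Real.log n := Real.log_le_log (by norm_num) hn1
  have hs : ((n.sqrt + 1 : ℕ) : ℝ) ≤ 2 * √n := by
    have h1 : (n.sqrt : ℝ) ≤ √n := Real.nat_sqrt_le_real_sqrt
    have h2 : (1 : ℝ) ≤ √n := Real.one_le_sqrt.2 (by linarith)
    push_cast
    linarith
  have hc : (Nat.clog 2 n : ℝ) ≤ 2 * Real.log n / Real.log 2 := by
    have h1 : 2 ^ (Nat.clog 2 n - 1) < n := Nat.pow_pred_clog_lt_self (by norm_num) hn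
    have h2 : Real.log ((2 : ℝ) ^ (Nat.clog 2 n - 1)) ≤ Real.log n :=
      Real.log_le_log (by positivity) (by exact_mod_cast h1.le)
    have h3 : 1 ≤ Nat.clog 2 n := Nat.clog_pos (by norm_num) hn
    rw [Real.log_pow, Nat.cast_sub h3, Nat.cast_one] at h2
    rw [le_div_iff₀ (by linarith)]
    linarith
  have hc' : (Nat.clog 2 n : ℝ) ≤ 3 * Real.log n := by
    refine hc.trans ?_
    rw [div_le_iff₀ (by linarith)]
    nlinarith
  have h1 : 1 + 10 * (Nat.clog 2 n : ℝ) ≤ 32 * Real.log n := by linarith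
  calc _ ≤ 2 * √n * (32 * Real.log n) := mul_le_mul hs h1 (by positivity) (by positivity)
    _ = _ := by ring

theorem upper_bound (hn : 2 ≤ n) : ∃ A : Algorithm n (Work n), ∀ x : Fin n → Bool,
    A.successProb x = 1 ∧ A.expectedQueries x ≤ ENNReal.ofReal (64 * (√n * Real.log n)) := by
  have h := solves_prefixGram_sq (Nat.le_pow_clog (by norm_num : 1 < 2) n) (n.sqrt + 1) 0
    (by rw [add_zero, sq]; exact (Nat.lt_succ_sqrt n).le)
  have h1 := h.smul (s := (n.factorial : ℝ)⁻¹) (by positivity)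
  have hf : (n.factorial : ℝ) ≠ 0 := by exact_mod_cast n.factorial_ne_zero
  have h2 : (fun x y : Fin n → Bool => (n.factorial : ℝ)⁻¹ * prefixGram n (min (0 ^ 2) n) x y) =
      fun _ _ => 1 := by
    funext x y
    rw [show min (0 ^ 2) n = 0 by simp, prefixGram_zero, inv_mul_cancel₀ hf]
  rw [h2, inv_mul_cancel_left₀ hf] at h1
  exact (h1.mono (sqrt_mul_clog_le hn)).exists_algorithm

end Rounds

end WildcardSearch

theorem theorem1 :
    -- Upper bound: an algorithm with a finite-dimensional workspace that finds `x` with certainty.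
    (∃ C : ℝ, 0 < C ∧ ∀ n : ℕ, 2 ≤ n →
      ∃ (ι : Type) (_ : Fintype ι) (A : WildcardSearch.Algorithm n (EuclideanSpace ℂ ι)),
        ∀ x : Fin n → Bool,
          A.successProb x = 1 ∧
          A.expectedQueries x ≤ ENNReal.ofReal (C * (Real.sqrt n * Real.log n))) ∧
    -- Lower bound: any algorithm with any Hilbert space as workspace and error at most `ε`.
    (∀ ε : ℝ, 0 ≤ ε → ε < 1 / 2 →
      ∃ c : ℝ, 0 < c ∧ ∀ (n : ℕ) (W : Type*) [NormedAddCommGroup W] [InnerProductSpace ℂ W]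
        [CompleteSpace W] (A : WildcardSearch.Algorithm n W),
        (∀ x : Fin n → Bool, ENNReal.ofReal (1 - ε) ≤ A.successProb x) →
        ∃ x : Fin n → Bool, ENNReal.ofReal (c * Real.sqrt n) ≤ A.expectedQueries x) := by
  refine ⟨⟨64, by norm_num, fun n hn => ⟨WildcardSearch.WorkIndex n, inferInstance,
    WildcardSearch.upper_bound hn⟩⟩, fun ε hε hε2 => ?_⟩
  obtain ⟨c, hc, h⟩ := WildcardSearch.lower_bound hε hε2
  exact ⟨c, hc, fun n W _ _ _ A hA => h n W A hA⟩
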